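/- Notation. Let $d\ge 1$. For $z=(x,\omega)\in\mathbb R^{2d}$ let $\pi(z)$ be the unitary operator on $L^2(\mathbb R^d)$ given by $\pi(z)\psi(t)=e^{2\pi i\omega\cdot t}\psi(t-x)$, and let $P\psi(t)=\psi(-t)$. For bounded operators $A$ on $L^2(\mathbb R^d)$ write $\alpha_z(A)=\pi(z)A\pi(z)^*$ and $\check A=PAP$; for trace class operators $A,B$ let $A\star B(z)=\mathrm{tr}(A\,\alpha_z(\check B))$, $z\in\mathbb R^{2d}$, and for $f\in L^1(\mathbb R^{2d})$ let $f\star A=\int_{\mathbb R^{2d}} f(z)\,\alpha_z(A)\,dz$ (weakly). Put $\tilde S=S\star\check S$, and let $M^*_{op}$ be the set of positive trace class operators $S$ on $L^2(\mathbb R^d)$ with $\mathrm{tr}(S)=1$ and $$\|S\|_{M^*_{op}}^2:=\int_{\mathbb R^{2d}}\tilde S(z)\,|z|\,dz<\infty ,$$ where $|z|$ is the Euclidean norm. For a compact set $\Omega\subset\mathbb R^{2d}$ let $|\Omega|$ be its Lebesgue measure and let $|\partial\Omega|=\mathrm{Var}(\chi_\Omega)=\sup\{\int_\Omega \mathrm{div}\,\varphi\,dz:\varphi\in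 C^1_c(\mathbb R^{2d};\mathbb R^{2d}),\ |\varphi|\le 1\}$ be its perimeter. Let $$\chi_\Omega\star S=\sum_{k=1}^\infty\lambda_k^\Omega\, h_k^\Omega\otimes h_k^\Omega ,\qquad \lambda_1^\Omega\ge\lambda_2^\Omega\ge\cdots,$$ be a spectral representation with $(h_k^\Omega)_k$ orthonormal and convergence in operator norm, where $(h\otimes h)\psi=\langle\psi,h\rangle h$. Put $$Q_S(\psi)=\check S\star(\psi\otimes\psi),\qquad \rho_\Omega^S(z)=\sum_{k=1}^{\lceil|\Omega|\rceil}Q_S(h_k^\Omega)(z).$$ Theorem (Non-asymptotic convergence). There is an absolute constant $C>0$ such that the following holds for every $d\ge 1$. Let $S\in M^*_{op}$ and let $\Omega\subset\mathbb R^{2d}$ be compact with finite perimeter, with $\|S\|^2_{M^*_{op}}\,|\partial\Omega|\ge 1$. Then, for every spectral representation of $\chi_\Omega\star S$ as above and every $\delta>0$, $$\bigl|\{z\in\mathbb R^{2d}: |\rho_\Omega^S(z)-\chi_\Omega(z)|>\delta\}\bigr|\le \frac{C}{\delta^{2}}\,\|S\|^2_{M^*_{op}}\,|\partial\Omega| .$$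 -/

import Mathlib

open MeasureTheory Filter Topology
open scoped ENNReal InnerProductSpace ComplexOrder

noncomputable section

/-! ### Time-frequency analysis on `L²(ℝᵈ)` -/

/-- Configuration space `ℝᵈ` with the Euclidean norm. -/
abbrev ConfigSpace (d : ℕ) : Type := EuclideanSpace ℝ (Fin d)

/-- Phase space `ℝ²ᵈ = ℝᵈ × ℝᵈ` with the Euclidean norm and Lebesgue measure;
a point is `z = (x, ω)` with `x = z.fst` and `ω = z.snd`. -/
abbrev PhaseSpace (d : ℕ) : Type := WithLp 2 (ConfigSpace d × ConfigSpace d)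

/-- The Hilbert space `L²(ℝᵈ)` of complex-valued functions. The inner product `⟪f, g⟫_ℂ` of
Mathlib is antilinear in the first argument. -/
abbrev L2Space (d : ℕ) : Type := Lp ℂ 2 (volume : Measure (ConfigSpace d))

/-- Bounded operators on `L²(ℝᵈ)`. -/
abbrev BddOp (d : ℕ) : Type := L2Space d →L[ℂ] L2Space d

/-- Translation `T_x ψ(t) = ψ(t - x)`. -/
def translation {d : ℕ} (x : ConfigSpace d) : L2Space d →ₗᵢ[ℂ] L2Space d :=
  Lp.compMeasurePreservingₗᵢ ℂ (fun t => t - x) (measurePreserving_sub_right volume x)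

/-- The character `t ↦ exp(2πi ω·t)`. -/
def character {d : ℕ} (w t : ConfigSpace d) : ℂ :=
  Complex.exp (2 * Real.pi * Complex.I * ((inner ℝ w t : ℝ) : ℂ))

lemma norm_character {d : ℕ} (w t : ConfigSpace d) : ‖character w t‖ = 1 := by
  have h : (2 * Real.pi * Complex.I * ((inner ℝ w t : ℝ) : ℂ))
      = ((2 * Real.pi * (inner ℝ w t : ℝ) : ℝ) : ℂ) * Complex.I := by
    push_cast; ring
  rw [character, h, Complex.norm_exp_ofReal_mul_I]

lemma continuous_character {d : ℕ} :
    Continuous (fun p : ConfigSpace d × ConfigSpace d => character p.1 p.2) := by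
  unfold character
  fun_prop

lemma memLp_character_mul {d : ℕ} (w : ConfigSpace d) (ψ : L2Space d) :
    MemLp (fun t => character w t * ψ t) 2 (volume : Measure (ConfigSpace d)) := by
  refine (Lp.memLp ψ).of_le ?_ ?_
  · exact ((continuous_character.comp
      (Continuous.prodMk continuous_const continuous_id)).aestronglyMeasurable).mul
      (Lp.aestronglyMeasurable ψ)
  · exact Eventually.of_forall fun t => by simp [norm_character]

/-- Modulation `M_ω ψ(t) = exp(2πi ω·t) ψ(t)`. -/
def modulation {d : ℕ} (w : ConfigSpace d) : L2Space d →ₗᵢ[ℂ] L2Space d where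
  toFun ψ := (memLp_character_mul w ψ).toLp
  map_add' ψ φ := by
    rw [← MemLp.toLp_add]
    apply MemLp.toLp_congr
    filter_upwards [Lp.coeFn_add ψ φ] with t ht
    rw [ht]
    exact mul_add _ _ _
  map_smul' c ψ := by
    rw [RingHom.id_apply, ← MemLp.toLp_const_smul]
    apply MemLp.toLp_congr
    filter_upwards [Lp.coeFn_smul c ψ] with t ht
    rw [ht]
    exact mul_left_comm _ _ _
  norm_map' ψ := by
    change ‖(memLp_character_mul w ψ).toLp‖ = ‖ψ‖
    rw [Lp.norm_toLp, Lp.norm_def]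
    congr 1
    apply eLpNorm_congr_norm_ae
    exact Eventually.of_forall fun t => by simp [norm_character]

/-- The time-frequency shift `π(z) = M_ω T_x` for `z = (x, ω)`. -/
def timeFreqShift {d : ℕ} (z : PhaseSpace d) : L2Space d →ₗᵢ[ℂ] L2Space d :=
  (modulation z.snd).comp (translation z.fst)

/-- The translate `α_z(A) = π(z) A π(z)^*` of an operator. -/
def opShift {d : ℕ} (z : PhaseSpace d) (A : BddOp d) : BddOp d :=
  (timeFreqShift z).toContinuousLinearMap ∘L A ∘L
    ContinuousLinearMap.adjoint (timeFreqShift z).toContinuousLinearMap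

/-- The parity operator `P ψ(t) = ψ(-t)`. -/
def parity (d : ℕ) : BddOp d :=
  (Lp.compMeasurePreservingₗᵢ ℂ (fun t : ConfigSpace d => -t)
    (Measure.measurePreserving_neg volume)).toContinuousLinearMap

/-- `Ǎ = P A P`. -/
def opCheck {d : ℕ} (A : BddOp d) : BddOp d := parity d ∘L A ∘L parity d

/-! ### Trace class operators -/

section TraceClass

variable {H : Type*} [NormedAddCommGroup H] [InnerProductSpace ℂ H] [CompleteSpace H]

/-- The index set of a fixed orthonormal basis of the Hilbert space `H`. -/
def onbIndex (H : Type*) [NormedAddCommGroup H] [InnerProductSpace ℂ H] [CompleteSpace H] :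
    Set H :=
  Classical.choose (exists_hilbertBasis ℂ H)

/-- A fixed orthonormal basis of `H`, used to define the trace (the trace of a positive or trace
class operator does not depend on this choice). -/
def onb (H : Type*) [NormedAddCommGroup H] [InnerProductSpace ℂ H] [CompleteSpace H] :
    HilbertBasis (onbIndex H) ℂ H :=
  Classical.choose (Classical.choose_spec (exists_hilbertBasis ℂ H))

/-- The trace `tr A = ∑ₖ ⟨A eₖ, eₖ⟩` (linear in the slot of `A eₖ`). -/
def opTrace (A : H →L[ℂ] H) : ℂ := ∑' i, ⟪onb H i, A (onb H i)⟫_ℂ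

/-- Trace class operators: compact operators `A` with `tr |A| < ∞`, where `|A| = (A^* A)^{1/2}`. -/
def IsTraceClass (A : H →L[ℂ] H) : Prop :=
  IsCompactOperator A ∧ Summable fun i => (⟪onb H i, (CFC.abs A) (onb H i)⟫_ℂ).re

/-- `T = ∑ₖ λₖ hₖ ⊗ hₖ`, with convergence in operator norm, `(hₖ)` orthonormal and
`λ₀ ≥ λ₁ ≥ …`; here `(h ⊗ h) ψ = ⟨ψ, h⟩ h`. Hence `T hₖ = λₖ hₖ`, and every nonzero eigenvalue of
`T` occurs among the `λₖ` with its multiplicity. -/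
structure IsSpectralRep (T : H →L[ℂ] H) (lam : ℕ → ℝ) (h : ℕ → H) : Prop where
  orthonormal : Orthonormal ℂ h
  antitone : Antitone lam
  hasSum : HasSum (fun k => (lam k : ℂ) • InnerProductSpace.rankOne ℂ (h k) (h k)) T

end TraceClass

/-! ### Density operators and convolutions -/

/-- Density operators: positive trace class operators of trace one. -/
structure IsDensityOperator {d : ℕ} (S : BddOp d) : Prop where
  traceClass : IsTraceClass S
  pos : S.IsPositive
  trace_eq_one : opTrace S = 1

/-- The convolution of two operators, the function `S ⋆ T (z) = tr(S α_z(Ť))` on phase space. -/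
def opConv {d : ℕ} (S T : BddOp d) (z : PhaseSpace d) : ℂ :=
  opTrace (S ∘L opShift z (opCheck T))

/-- `S̃ = S ⋆ Š`. (For `S ≥ 0` the values of `S ⋆ Š` are real and nonnegative, so taking the real
part only changes the codomain.) -/
def tildeFun {d : ℕ} (S : BddOp d) (z : PhaseSpace d) : ℝ := (opConv S (opCheck S) z).re

/-- The class `M*_op` of density operators with `∫ S̃(z) |z| dz < ∞`. -/
structure IsMopStar {d : ℕ} (S : BddOp d) : Prop extends IsDensityOperator S where
  integrable : Integrable (fun z : PhaseSpace d => tildeFun S z * ‖z‖) volume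

/-- `‖S‖²_{M*_op} = ∫ S̃(z) |z| dz`. -/
def mopStarNormSq {d : ℕ} (S : BddOp d) : ℝ := ∫ z : PhaseSpace d, tildeFun S z * ‖z‖

lemma continuous_translation {d : ℕ} (ψ : L2Space d) :
    Continuous (fun x : ConfigSpace d => translation x ψ) := by
  have hg : Continuous (fun x : ConfigSpace d =>
      (⟨fun t => t - x, by fun_prop⟩ : C(ConfigSpace d, ConfigSpace d))) :=
    ContinuousMap.continuous_of_continuous_uncurry _ (by
      change Continuous fun p : ConfigSpace d × ConfigSpace d => p.2 - p.1
      fun_prop)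
  exact Continuous.compMeasurePreservingLp (f := fun _ : ConfigSpace d => ψ) continuous_const hg
    (fun x => measurePreserving_sub_right volume x) (by simp)

lemma continuous_of_weak_of_norm {X H : Type*} [TopologicalSpace X] [NormedAddCommGroup H]
    [InnerProductSpace ℂ H] {u : X → H} {c : ℝ} (hc : ∀ x, ‖u x‖ = c)
    (hw : ∀ v, Continuous fun x => ⟪v, u x⟫_ℂ) : Continuous u := by
  rw [continuous_iff_continuousAt]
  intro a
  rw [ContinuousAt, tendsto_iff_norm_sub_tendsto_zero]
  have h2 : Tendsto (fun x => ‖u x - u a‖ ^ 2) (𝓝 a) (𝓝 0) := by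
    have h1 : ∀ x, ‖u x - u a‖ ^ 2 = c ^ 2 - 2 * (⟪u a, u x⟫_ℂ).re + c ^ 2 := by
      intro x
      rw [@norm_sub_sq ℂ, hc, hc, inner_re_symm]
      rfl
    simp_rw [h1]
    have h3 : Continuous fun x => c ^ 2 - 2 * (⟪u a, u x⟫_ℂ).re + c ^ 2 := by
      have := Complex.continuous_re.comp (hw (u a))
      fun_prop
    have h4 := h3.tendsto a
    have h5 : (⟪u a, u a⟫_ℂ).re = c ^ 2 := by
      rw [inner_self_eq_norm_sq_to_K, hc]
      norm_cast
    rw [h5] at h4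
    convert h4 using 2
    ring
  have h6 := h2.sqrt
  simpa using h6

lemma continuous_modulation {d : ℕ} (ψ : L2Space d) :
    Continuous (fun w : ConfigSpace d => modulation w ψ) := by
  refine continuous_of_weak_of_norm (c := ‖ψ‖) (fun w => (modulation w).norm_map ψ) fun φ => ?_
  have h1 : ∀ w : ConfigSpace d, ⟪φ, modulation w ψ⟫_ℂ
      = ∫ t, character w t * ⟪φ t, ψ t⟫_ℂ := by
    intro w
    rw [L2.inner_def]
    refine integral_congr_ae ?_
    filter_upwards [MemLp.coeFn_toLp (memLp_character_mul w ψ)] with t ht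
    change ⟪φ t, ((memLp_character_mul w ψ).toLp : L2Space d) t⟫_ℂ = _
    rw [ht, ← smul_eq_mul, inner_smul_right]
  simp_rw [h1]
  have hint := L2.integrable_inner (𝕜 := ℂ) φ ψ
  refine continuous_of_dominated (bound := fun t => ‖⟪φ t, ψ t⟫_ℂ‖) ?_ ?_ hint.norm ?_
  · intro w
    exact ((continuous_character.comp
      (Continuous.prodMk continuous_const continuous_id)).aestronglyMeasurable).mul
      hint.aestronglyMeasurable
  · intro w
    exact Eventually.of_forall fun t => by simp [norm_character]
  · refine Eventually.of_forall fun t => ?_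
    exact (continuous_character.comp
      (Continuous.prodMk continuous_id continuous_const)).mul continuous_const

lemma continuous_apply_of_isometry {X H : Type*} [TopologicalSpace X] [NormedAddCommGroup H]
    [InnerProductSpace ℂ H] {U : X → H →ₗᵢ[ℂ] H} (hU : ∀ v, Continuous fun x => U x v)
    {g : X → H} (hg : Continuous g) : Continuous fun x => U x (g x) := by
  rw [continuous_iff_continuousAt]
  intro a
  have h1 := (hU (g a)).tendsto a
  have h2 : Tendsto (fun x => U x (g x - g a)) (𝓝 a) (𝓝 0) := by
    rw [tendsto_zero_iff_norm_tendsto_zero]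
    simp_rw [LinearIsometry.norm_map]
    have := ((hg.sub continuous_const).norm).tendsto a (f := fun x => ‖g x - g a‖)
    simpa using this
  have h3 := h2.add h1
  simpa [ContinuousAt] using h3

lemma continuous_timeFreqShift {d : ℕ} (ψ : L2Space d) :
    Continuous (fun z : PhaseSpace d => timeFreqShift z ψ) := by
  have hf : Continuous fun z : PhaseSpace d => z.fst := by fun_prop
  have hs : Continuous fun z : PhaseSpace d => z.snd := by fun_prop
  exact continuous_apply_of_isometry (U := fun z : PhaseSpace d => modulation z.snd)
    (fun v => (continuous_modulation v).comp hs) ((continuous_translation ψ).comp hf)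

lemma translation_surjective {d : ℕ} (x : ConfigSpace d) :
    Function.Surjective (translation x) := by
  intro ψ
  refine ⟨translation (-x) ψ, ?_⟩
  have h := Lp.compMeasurePreserving_comp_apply ψ
    (measurePreserving_sub_right (volume : Measure (ConfigSpace d)) (-x))
    (measurePreserving_sub_right (volume : Measure (ConfigSpace d)) x)
  refine h.symm.trans ?_
  have h2 : ((fun t : ConfigSpace d => t - -x) ∘ fun t => t - x) = id := by
    funext t; simp
  refine Lp.ext ?_
  refine (Lp.coeFn_compMeasurePreserving _ _).trans ?_
  rw [h2]
  rfl

lemma modulation_surjective {d : ℕ} (w : ConfigSpace d) :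
    Function.Surjective (modulation w) := by
  intro ψ
  refine ⟨modulation (-w) ψ, ?_⟩
  refine Lp.ext ?_
  refine (MemLp.coeFn_toLp (memLp_character_mul w (modulation (-w) ψ))).trans ?_
  filter_upwards [MemLp.coeFn_toLp (memLp_character_mul (-w) ψ)] with t ht
  have h1 : (modulation (-w) ψ) t = character (-w) t * ψ t := ht
  rw [h1, ← mul_assoc, character, character, ← Complex.exp_add]
  simp

lemma timeFreqShift_surjective {d : ℕ} (z : PhaseSpace d) :
    Function.Surjective (timeFreqShift z) :=
  (modulation_surjective z.snd).comp (translation_surjective z.fst)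

lemma continuous_timeFreqShift_adjoint {d : ℕ} (ψ : L2Space d) :
    Continuous (fun z : PhaseSpace d =>
      ContinuousLinearMap.adjoint (timeFreqShift z).toContinuousLinearMap ψ) := by
  refine continuous_of_weak_of_norm (c := ‖ψ‖) (fun z => ?_) fun v => ?_
  · obtain ⟨φ, rfl⟩ := timeFreqShift_surjective z ψ
    have h : ContinuousLinearMap.adjoint (timeFreqShift z).toContinuousLinearMap
        (timeFreqShift z φ) = φ := by
      refine ext_inner_left ℂ fun v => ?_
      rw [ContinuousLinearMap.adjoint_inner_right]
      exact (timeFreqShift z).inner_map_map v φ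
    rw [h, LinearIsometry.norm_map]
  · simp_rw [ContinuousLinearMap.adjoint_inner_right]
    exact (continuous_timeFreqShift v).inner continuous_const

/-- `z ↦ α_z(A) ψ` is continuous, so the integral defining `f ⋆ A` below is absolutely
convergent. -/
lemma continuous_opShift {d : ℕ} (A : BddOp d) (ψ : L2Space d) :
    Continuous (fun z : PhaseSpace d => opShift z A ψ) :=
  continuous_apply_of_isometry (U := fun z : PhaseSpace d => timeFreqShift z)
    continuous_timeFreqShift (A.continuous.comp (continuous_timeFreqShift_adjoint ψ))

lemma norm_opShift_apply_le {d : ℕ} (z : PhaseSpace d) (A : BddOp d) (ψ : L2Space d) :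
    ‖opShift z A ψ‖ ≤ ‖A‖ * ‖ψ‖ := by
  have h1 : ‖opShift z A ψ‖
      = ‖A (ContinuousLinearMap.adjoint (timeFreqShift z).toContinuousLinearMap ψ)‖ :=
    (timeFreqShift z).norm_map _
  rw [h1]
  refine (A.le_opNorm _).trans (mul_le_mul_of_nonneg_left ?_ (norm_nonneg _))
  refine (ContinuousLinearMap.le_opNorm _ _).trans ?_
  rw [LinearIsometryEquiv.norm_map]
  exact mul_le_of_le_one_left (norm_nonneg _) (LinearIsometry.norm_toContinuousLinearMap_le _)

lemma integrable_smul_opShift {d : ℕ} {f : PhaseSpace d → ℂ} (hf : Integrable f volume)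
    (A : BddOp d) (ψ : L2Space d) :
    Integrable (fun z => f z • opShift z A ψ) volume :=
  hf.smul_bdd (‖A‖ * ‖ψ‖) (continuous_opShift A ψ).aestronglyMeasurable
    (Eventually.of_forall fun z => norm_opShift_apply_le z A ψ)

/-- The convolution of `f ∈ L¹(ℝ²ᵈ)` with an operator, `f ⋆ A = ∫ f(z) α_z(A) dz`. -/
def funOpConv {d : ℕ} (f : PhaseSpace d → ℂ) (hf : Integrable f volume) (A : BddOp d) :
    BddOp d :=
  LinearMap.mkContinuous
    { toFun := fun ψ => ∫ z, f z • opShift z A ψ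
      map_add' := fun ψ φ => by
        simp_rw [map_add, smul_add]
        exact integral_add (integrable_smul_opShift hf A ψ) (integrable_smul_opShift hf A φ)
      map_smul' := fun c ψ => by
        simp_rw [map_smul, smul_comm (f _) c]
        exact integral_smul c _ }
    ((∫ z, ‖f z‖) * ‖A‖) (fun ψ => by
      change ‖∫ z, f z • opShift z A ψ‖ ≤ _
      rw [mul_assoc, ← integral_mul_const]
      refine norm_integral_le_of_norm_le (hf.norm.mul_const _) (Eventually.of_forall fun z => ?_)
      rw [norm_smul]
      exact mul_le_mul_of_nonneg_left (norm_opShift_apply_le z A ψ) (norm_nonneg _))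

/-- The weak form `⟨(f ⋆ A) ψ, ξ⟩ = ∫ f(z) ⟨α_z(A) ψ, ξ⟩ dz`. -/
lemma inner_funOpConv {d : ℕ} (f : PhaseSpace d → ℂ) (hf : Integrable f volume) (A : BddOp d)
    (ψ ξ : L2Space d) :
    ⟪ξ, funOpConv f hf A ψ⟫_ℂ = ∫ z, f z * ⟪ξ, opShift z A ψ⟫_ℂ := by
  change ⟪ξ, ∫ z, f z • opShift z A ψ⟫_ℂ = _
  rw [← integral_inner (integrable_smul_opShift hf A ψ)]
  simp_rw [inner_smul_right]

/-- The characteristic function `χ_Ω`, complex-valued. -/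
def charFunSet {d : ℕ} (Ω : Set (PhaseSpace d)) : PhaseSpace d → ℂ := Ω.indicator fun _ => 1

lemma integrable_charFunSet {d : ℕ} {Ω : Set (PhaseSpace d)} (hΩ : IsCompact Ω) :
    Integrable (charFunSet Ω) volume :=
  (integrable_indicator_iff hΩ.measurableSet).2
    (integrableOn_const hΩ.measure_lt_top.ne)

/-- The mixed-state localization operator `χ_Ω ⋆ S`. -/
def mixedLocOp {d : ℕ} (Ω : Set (PhaseSpace d)) (hΩ : IsCompact Ω) (S : BddOp d) : BddOp d :=
  funOpConv (charFunSet Ω) (integrable_charFunSet hΩ) S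

/-- The Cohen class distribution `Q_S(ψ) = Š ⋆ (ψ ⊗ ψ)`. -/
def cohen {d : ℕ} (S : BddOp d) (ψ : L2Space d) (z : PhaseSpace d) : ℂ :=
  opConv (opCheck S) (InnerProductSpace.rankOne ℂ ψ ψ) z

/-- The accumulated Cohen class distribution `ρ = ∑ Q_S(hₖ)`, summed over the first `⌈|Ω|⌉`
members of the sequence `h` (of eigenfunctions of `χ_Ω ⋆ S`). -/
def accCohen {d : ℕ} (S : BddOp d) (Ω : Set (PhaseSpace d)) (h : ℕ → L2Space d)
    (z : PhaseSpace d) : ℂ :=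
  ∑ k ∈ Finset.range ⌈(volume Ω).toReal⌉₊, cohen S (h k) z

/-! ### Perimeter -/

/-- The variation `Var(f) = sup {∫ f div φ : φ ∈ C_c^1(E; E), |φ| ≤ 1}`. -/
def variation {E : Type*} [NormedAddCommGroup E] [NormedSpace ℝ E] [MeasureSpace E]
    (f : E → ℝ) : ℝ≥0∞ :=
  ⨆ (φ : E → E) (_ : ContDiff ℝ 1 φ) (_ : HasCompactSupport φ) (_ : ∀ x, ‖φ x‖ ≤ 1),
    ENNReal.ofReal (∫ x, f x * LinearMap.trace ℝ E (fderiv ℝ φ x).toLinearMap)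

/-- The perimeter `|∂Ω| = Var(χ_Ω)`. -/
def perimeter {d : ℕ} (Ω : Set (PhaseSpace d)) : ℝ≥0∞ := variation (Ω.indicator fun _ => (1 : ℝ))

end

/-!
Write `T = χ_Ω ⋆ S`, `M = ‖S‖² |∂Ω|`, `N = ⌈|Ω|⌉`, and let `hₖ`, `λₖ` be the eigenfunctions and
eigenvalues of `T`. The proof shows `‖ρ - χ_Ω‖₁ ≤ 4 M`. Markov's inequality then gives the bound
`4 M / δ`, which is stronger than `4 M / δ²` for `δ ≤ 1`; for `δ > 1` the set in question is empty,
because `0 ≤ ρ ≤ tr S = 1` pointwise (`tsum_cohenDensity_le_one`).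

With the Hilbert-Schmidt operator `S^{1/2}` and the vectors `rᵢ = S^{1/2} eᵢ` for an orthonormal
basis `(eᵢ)`, one has `Q_S(h)(z) = ∑ᵢ |⟨π(z) rᵢ, h⟩|²` and `S̃(z) = ∑ᵢⱼ |⟨π(z) rᵢ, rⱼ⟩|²`, so that
all quantities are series of nonnegative terms and may be rearranged freely. Moyal's identity
`∫ |⟨π(z) g, f⟩|² dz = ‖g‖² ‖f‖²` (`lintegral_enorm_inner_timeFreqShift_sq`, a consequence of
Plancherel's theorem) gives `∫ Q_S(hₖ) = 1` and `∫ S̃ = 1`. Expanding the quadratic form of `T`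
gives `λₖ = ∫_Ω Q_S(hₖ) ∈ [0, 1]`, `∑ λₖ = |Ω|`, `∑ λₖ Q_S(hₖ) = χ_Ω * S̃` and
`∑ λₖ² = ∫_Ω χ_Ω * S̃` (`tsum_eigenvalue`, `tsum_eigenvalue_mul_cohenDensity`,
`tsum_eigenvalue_sq`).

Geometry enters through `‖χ_Ω - χ_Ω(· - v)‖₁ ≤ |v| |∂Ω|` (`lintegral_enorm_indicator_sub_le`).
Integrated against `S̃`, it gives `‖χ_Ω - χ_Ω * S̃‖₁ ≤ M`, and hence also `∑ λₖ (1 - λₖ) ≤ M`. As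
`(λₖ)` is decreasing with sum `|Ω|`, the latter forces `∑_{k ≥ N} λₖ ≤ M` and
`∑_{k < N} (1 - λₖ) ≤ 1 + M` (`sum_one_sub_and_tsum_tail_le`). Therefore
`‖ρ - χ_Ω * S̃‖₁ ≤ ∑_{k < N} (1 - λₖ) + ∑_{k ≥ N} λₖ ≤ 1 + 2 M`, and altogether
`‖ρ - χ_Ω‖₁ ≤ 1 + 3 M ≤ 4 M`.
-/

noncomputable section

/-! ### Plancherel's identity for the Fourier integral -/

lemma eLpNorm_two_sq_eq_lintegral {α : Type*} [MeasurableSpace α] (μ : Measure α) (u : α → ℂ) :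
    eLpNorm u 2 μ ^ 2 = ∫⁻ t, ‖u t‖ₑ ^ 2 ∂μ := by
  have h := eLpNorm_nnreal_pow_eq_lintegral (f := u) (μ := μ) (p := 2) (by simp)
  norm_num at h
  exact h

section Plancherel

open FourierTransform SchwartzMap

variable {V : Type*} [NormedAddCommGroup V] [InnerProductSpace ℝ V] [FiniteDimensional ℝ V]
  [MeasurableSpace V] [BorelSpace V]

lemma continuous_fourier_of_integrable {F : V → ℂ} (h1 : Integrable F) : Continuous (𝓕 F) :=
  VectorFourier.fourierIntegral_continuous Real.continuous_fourierChar
    (L := innerₗ V) continuous_inner h1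

/-- The Fourier integral of a function in `L¹ ∩ L²` represents its `L²` Fourier transform: both
define the same tempered distribution. -/
lemma fourier_ae_eq_fourier_toLp {F : V → ℂ} (h1 : Integrable F) (h2 : MemLp F 2) :
    𝓕 F =ᵐ[volume] (𝓕 (h2.toLp F) : Lp ℂ 2 (volume : Measure V)) := by
  refine ae_eq_of_integral_contDiff_smul_eq
    (continuous_fourier_of_integrable h1).locallyIntegrable
    ((Lp.memLp (𝓕 (h2.toLp F))).locallyIntegrable (by norm_num)) ?_
  intro g hg hgs
  have hg1 : HasCompactSupport (fun x => (g x : ℂ)) := hgs.comp_left (g := fun x : ℝ => (x : ℂ)) rfl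
  have hg2 : ContDiff ℝ (⊤ : ℕ∞) (fun x => (g x : ℂ)) := Complex.ofRealCLM.contDiff.comp hg
  let φ : 𝓢(V, ℂ) := hg1.toSchwartzMap hg2
  have hφ : ∀ x, φ x = (g x : ℂ) := fun x => rfl
  have e1 : ∫ x, g x • 𝓕 F x = ∫ x, 𝓕 F x • φ x := by
    refine integral_congr_ae (Eventually.of_forall fun x => ?_)
    simp [hφ, mul_comm]
  have e2 : ∫ x, 𝓕 F x • φ x = ∫ x, F x • (𝓕 (φ : V → ℂ)) x := by
    have := VectorFourier.integral_fourierIntegral_smul_eq_flip (μ := (volume : Measure V))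
      (ν := (volume : Measure V)) (f := F) (g := φ) Real.continuous_fourierChar
      (L := innerₗ V) continuous_inner h1 φ.integrable
    rw [flip_innerₗ] at this
    exact this
  have e3 := congrArg (fun u => u φ) (Lp.fourier_toTemperedDistribution_eq (h2.toLp F))
  simp only [TemperedDistribution.fourier_apply, Lp.toTemperedDistribution_apply] at e3
  rw [e1, e2]
  have e4 : ∫ x, F x • (𝓕 (φ : V → ℂ)) x = ∫ x, (𝓕 φ) x • (h2.toLp F) x := by
    refine integral_congr_ae ?_
    filter_upwards [h2.coeFn_toLp] with x hx
    rw [hx, SchwartzMap.fourier_coe, smul_eq_mul, smul_eq_mul, mul_comm]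
  rw [e4, e3]
  refine integral_congr_ae (Eventually.of_forall fun x => ?_)
  simp [hφ]

/-- Plancherel's identity for the Fourier integral of a function in `L¹ ∩ L²`. -/
lemma lintegral_enorm_fourier_sq {F : V → ℂ} (h1 : Integrable F) (h2 : MemLp F 2) :
    ∫⁻ w, ‖𝓕 F w‖ₑ ^ 2 = ∫⁻ t, ‖F t‖ₑ ^ 2 := by
  rw [← eLpNorm_two_sq_eq_lintegral, ← eLpNorm_two_sq_eq_lintegral,
    eLpNorm_congr_ae (fourier_ae_eq_fourier_toLp h1 h2), ← Lp.enorm_def]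
  have h3 := Lp.norm_fourier_eq (h2.toLp F)
  rw [← ofReal_norm, h3, ofReal_norm, Lp.enorm_def,
    eLpNorm_congr_ae h2.coeFn_toLp]

end Plancherel

/-! ### Moyal's identity -/

section Moyal

open FourierTransform

lemma lintegral_enorm_sq_L2 {d : ℕ} (f : L2Space d) : ∫⁻ t, ‖f t‖ₑ ^ 2 = ‖f‖ₑ ^ 2 := by
  rw [Lp.enorm_def, eLpNorm_two_sq_eq_lintegral]

lemma coeFn_timeFreqShift {d : ℕ} (z : PhaseSpace d) (g : L2Space d) :
    timeFreqShift z g =ᵐ[volume] fun t => character z.snd t * g (t - z.fst) := by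
  refine (MemLp.coeFn_toLp (memLp_character_mul z.snd (translation z.fst g))).trans ?_
  have h : translation z.fst g =ᵐ[volume] fun t => g (t - z.fst) :=
    Lp.coeFn_compMeasurePreserving g (measurePreserving_sub_right volume z.fst)
  filter_upwards [h] with t ht
  rw [ht]

/-- For fixed `x`, the short-time Fourier transform is the Fourier integral in `t` of
`conj (g (t - x)) * f t`. -/
lemma inner_timeFreqShift_eq_fourier {d : ℕ} (x w : ConfigSpace d) (g f : L2Space d) :
    ⟪timeFreqShift (WithLp.toLp 2 (x, w)) g, f⟫_ℂ
      = 𝓕 (fun t => ⟪g (t - x), f t⟫_ℂ) w := by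
  rw [L2.inner_def, Real.fourier_eq']
  refine integral_congr_ae ?_
  filter_upwards [coeFn_timeFreqShift (WithLp.toLp 2 (x, w)) g] with t ht
  rw [ht]
  have hc : starRingEnd ℂ (character w t)
      = Complex.exp (↑(-2 * Real.pi * ⟪t, w⟫_ℝ) * Complex.I) := by
    rw [character, ← Complex.exp_conj]
    congr 1
    rw [real_inner_comm]
    simp [Complex.conj_ofNat]
    ring
  simp only [RCLike.inner_apply, map_mul, smul_eq_mul]
  change f t * (starRingEnd ℂ (character w t) * starRingEnd ℂ (g (t - x))) = _
  rw [hc]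
  ring

/-- Moyal's identity (orthogonality relations): `∫ |⟨π(z)g, f⟩|² dz = ‖g‖² ‖f‖²`. -/
lemma lintegral_enorm_inner_timeFreqShift_sq {d : ℕ} (g f : L2Space d) :
    ∫⁻ z : PhaseSpace d, ‖⟪timeFreqShift z g, f⟫_ℂ‖ₑ ^ 2 = ‖g‖ₑ ^ 2 * ‖f‖ₑ ^ 2 := by
  have hgm : StronglyMeasurable (g : ConfigSpace d → ℂ) := Lp.stronglyMeasurable g
  have hfm : StronglyMeasurable (f : ConfigSpace d → ℂ) := Lp.stronglyMeasurable f
  have hmeas : Measurable fun z : PhaseSpace d => ‖⟪timeFreqShift z g, f⟫_ℂ‖ₑ ^ 2 :=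
    ((continuous_timeFreqShift g).inner continuous_const).measurable.enorm.pow_const 2
  rw [← (WithLp.volume_preserving_toLp (ConfigSpace d) (ConfigSpace d)).lintegral_comp hmeas]
  rw [Measure.volume_eq_prod, lintegral_prod
    (fun p => ‖⟪timeFreqShift (WithLp.toLp 2 p) g, f⟫_ℂ‖ₑ ^ 2)
    (hmeas.comp (WithLp.measurable_toLp 2 _)).aemeasurable]
  simp_rw [inner_timeFreqShift_eq_fourier]
  -- By Tonelli, `conj (g (t - x)) * f t` is in `L²(dt)` for almost every `x`, so Plancherel's
  -- identity applies fibrewise.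
  have hshift : Measurable fun p : ConfigSpace d × ConfigSpace d => p.2 - p.1 := by fun_prop
  have hjm : Measurable fun p : ConfigSpace d × ConfigSpace d =>
      ‖⟪g (p.2 - p.1), f p.2⟫_ℂ‖ₑ ^ 2 :=
    (((hgm.measurable.comp hshift).inner (hfm.measurable.comp measurable_snd)).enorm.pow_const 2)
  have htot : ∫⁻ x, ∫⁻ t, ‖⟪g (t - x), f t⟫_ℂ‖ₑ ^ 2 = ‖g‖ₑ ^ 2 * ‖f‖ₑ ^ 2 := by
    rw [lintegral_lintegral_swap hjm.aemeasurable]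
    have : ∀ t, ∫⁻ x, ‖⟪g (t - x), f t⟫_ℂ‖ₑ ^ 2 = ‖g‖ₑ ^ 2 * ‖f t‖ₑ ^ 2 := by
      intro t
      have e : ∀ x, ‖⟪g (t - x), f t⟫_ℂ‖ₑ ^ 2 = ‖g (t - x)‖ₑ ^ 2 * ‖f t‖ₑ ^ 2 := by
        intro x
        rw [RCLike.inner_apply, enorm_mul, RCLike.enorm_conj, mul_pow, mul_comm]
      simp_rw [e]
      rw [lintegral_mul_const' _ _ (by finiteness),
        lintegral_sub_left_eq_self (fun x => ‖g x‖ₑ ^ 2) t, lintegral_enorm_sq_L2]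
    simp_rw [this]
    rw [lintegral_const_mul' _ _ (by finiteness), lintegral_enorm_sq_L2]
  rw [← htot]
  have hfin : ∀ᵐ x, ∫⁻ t, ‖⟪g (t - x), f t⟫_ℂ‖ₑ ^ 2 < ∞ :=
    ae_lt_top hjm.lintegral_prod_right' (by rw [htot]; finiteness)
  refine lintegral_congr_ae ?_
  filter_upwards [hfin] with x hx
  have hsx : AEStronglyMeasurable (fun t => ⟪g (t - x), f t⟫_ℂ) volume :=
    ((hgm.comp_measurable (by fun_prop)).inner hfm).aestronglyMeasurable
  refine lintegral_enorm_fourier_sq ?_ ?_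
  · have h : (fun t => ⟪g (t - x), f t⟫_ℂ) =ᵐ[volume] fun t => ⟪translation x g t, f t⟫_ℂ := by
      have h : translation x g =ᵐ[volume] fun t => g (t - x) :=
        Lp.coeFn_compMeasurePreserving g (measurePreserving_sub_right volume x)
      filter_upwards [h] with t ht
      rw [ht]
    exact (L2.integrable_inner (𝕜 := ℂ) (translation x g) f).congr h.symm
  · refine ⟨hsx, ?_⟩
    rw [← eLpNorm_two_sq_eq_lintegral] at hx
    by_contra hc
    rw [not_lt, top_le_iff] at hc
    rw [hc] at hx
    simp at hx

end Moyal

/-! ### Perimeter and translations -/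

section Perimeter

open scoped Convolution

lemma trace_smulRight {E : Type*} [NormedAddCommGroup E] [NormedSpace ℝ E]
    [FiniteDimensional ℝ E] (l : E →L[ℝ] ℝ) (v : E) :
    LinearMap.trace ℝ E (l.smulRight v).toLinearMap = l v := by
  have h : (l.smulRight v).toLinearMap
      = dualTensorHom ℝ E E (l.toLinearMap ⊗ₜ[ℝ] v) := by
    ext x; simp
  rw [h, LinearMap.trace_eq_contract_apply, contractLeft_apply]
  rfl

variable {E : Type*} [NormedAddCommGroup E] [NormedSpace ℝ E] [MeasureSpace E]

lemma integral_mul_divergence_le_variation {f : E → ℝ} (hf : variation f < ∞) {Φ : E → E}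
    (hΦ : ContDiff ℝ 1 Φ) (hc : HasCompactSupport Φ) (hb : ∀ x, ‖Φ x‖ ≤ 1) :
    ∫ x, f x * LinearMap.trace ℝ E (fderiv ℝ Φ x).toLinearMap ≤ (variation f).toReal := by
  rw [← ENNReal.ofReal_le_iff_le_toReal hf.ne]
  exact le_iSup₂_of_le Φ hΦ (le_iSup₂_of_le hc hb le_rfl)

variable [FiniteDimensional ℝ E]

/-- The variation controls the pairing with directional derivatives: test it on the vector field
`φ v / ‖v‖`. -/
lemma integral_mul_fderiv_apply_le_variation {f : E → ℝ} (hf : variation f < ∞) {φ : E → ℝ}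
    (hφ : ContDiff ℝ 1 φ) (hc : HasCompactSupport φ) (hb : ∀ x, |φ x| ≤ 1) (v : E) :
    ∫ x, f x * fderiv ℝ φ x v ≤ ‖v‖ * (variation f).toReal := by
  rcases eq_or_ne v 0 with rfl | hv
  · simp
  have hv' : 0 < ‖v‖ := norm_pos_iff.2 hv
  have h := integral_mul_divergence_le_variation hf (Φ := fun x => φ x • (‖v‖⁻¹ • v))
    (hφ.smul contDiff_const) hc.smul_right (fun x => by
      rw [norm_smul, norm_smul, norm_inv, norm_norm, inv_mul_cancel₀ hv'.ne', mul_one]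
      exact hb x)
  have h2 : ∀ x, LinearMap.trace ℝ E (fderiv ℝ (fun x => φ x • (‖v‖⁻¹ • v)) x).toLinearMap
      = ‖v‖⁻¹ * fderiv ℝ φ x v := by
    intro x
    rw [fderiv_smul_const ((hφ.differentiable one_ne_zero) x), trace_smulRight]
    simp
  simp_rw [h2] at h
  have h3 : ∫ x, f x * (‖v‖⁻¹ * fderiv ℝ φ x v) = ‖v‖⁻¹ * ∫ x, f x * fderiv ℝ φ x v := by
    rw [← integral_const_mul]
    congr 1 with x
    ring
  rw [h3, inv_mul_le_iff₀ hv'] at h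
  exact h

variable [BorelSpace E] [(volume : Measure E).IsAddHaarMeasure]

/-- Integrating the directional derivative along the segment from `x` to `x + v`. -/
lemma integral_mul_sub_le_variation {f : E → ℝ} (hi : Integrable f) (hf : variation f < ∞)
    {φ : E → ℝ} (hφ : ContDiff ℝ 1 φ) (hc : HasCompactSupport φ) (hb : ∀ x, |φ x| ≤ 1) (v : E) :
    ∫ x, f x * (φ (x + v) - φ x) ≤ ‖v‖ * (variation f).toReal := by
  have hcont : Continuous (fderiv ℝ φ) := hφ.continuous_fderiv one_ne_zero
  obtain ⟨K, hK⟩ := (hc.fderiv (𝕜 := ℝ)).exists_bound_of_continuous hcont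
  have hftc : ∀ x, φ (x + v) - φ x = ∫ s in (0 : ℝ)..1, fderiv ℝ φ (x + s • v) v := by
    intro x
    have hd : ∀ s ∈ Set.uIcc (0 : ℝ) 1,
        HasDerivAt (fun s : ℝ => φ (x + s • v)) (fderiv ℝ φ (x + s • v) v) s := by
      intro s _
      have h1 : HasDerivAt (fun s : ℝ => x + s • v) v s := by
        simpa using ((hasDerivAt_id s).smul_const v).const_add x
      exact ((hφ.differentiable one_ne_zero _).hasFDerivAt).comp_hasDerivAt s h1
    rw [intervalIntegral.integral_eq_sub_of_hasDerivAt hd]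
    · simp
    · exact Continuous.intervalIntegrable (by fun_prop) _ _
  have hint : Integrable (fun p : E × ℝ => f p.1 * fderiv ℝ φ (p.1 + p.2 • v) v)
      (volume.prod (volume.restrict (Set.Ioc (0 : ℝ) 1))) := by
    have h1 : Integrable (fun p : E × ℝ => f p.1)
        (volume.prod (volume.restrict (Set.Ioc (0 : ℝ) 1))) := hi.comp_fst _
    refine h1.mul_bdd (c := K * ‖v‖) (Continuous.aestronglyMeasurable (by fun_prop)) ?_
    refine Eventually.of_forall fun p => ?_
    exact ((fderiv ℝ φ _).le_opNorm v).trans (mul_le_mul_of_nonneg_right (hK _) (norm_nonneg v))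
  have h1 : ∫ x, f x * (φ (x + v) - φ x)
      = ∫ s in Set.Ioc (0 : ℝ) 1, ∫ x, f x * fderiv ℝ φ (x + s • v) v := by
    rw [← integral_integral_swap hint]
    congr 1 with x
    rw [hftc, intervalIntegral.integral_of_le zero_le_one, integral_const_mul]
  rw [h1]
  have h2 : ∀ s : ℝ, ∫ x, f x * fderiv ℝ φ (x + s • v) v ≤ ‖v‖ * (variation f).toReal := by
    intro s
    have h3 := integral_mul_fderiv_apply_le_variation hf (φ := fun x => φ (x + s • v))
      (hφ.comp (contDiff_id.add contDiff_const)) (hc.comp_homeomorph (Homeomorph.addRight (s • v)))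
      (fun x => hb _) v
    simpa only [fderiv_comp_add_right] using h3
  calc ∫ s in Set.Ioc (0 : ℝ) 1, ∫ x, f x * fderiv ℝ φ (x + s • v) v
      ≤ ∫ _s in Set.Ioc (0 : ℝ) 1, ‖v‖ * (variation f).toReal :=
        integral_mono hint.integral_prod_right (integrable_const _) h2
    _ = ‖v‖ * (variation f).toReal := by simp

/-- If `g`, bounded by `1`, pairs to at most `B` with every `C¹_c` function bounded by `1`, then
`∫ g² ≤ B`: mollifications of `g` are such test functions and converge to `g` almost everywhere. -/
lemma integral_sq_le_of_forall_integral_mul_le {g : E → ℝ} (hi : Integrable g)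
    (hb : ∀ x, |g x| ≤ 1) (hc : HasCompactSupport g) {B : ℝ}
    (h : ∀ φ : E → ℝ, ContDiff ℝ 1 φ → HasCompactSupport φ → (∀ x, |φ x| ≤ 1) →
      ∫ x, g x * φ x ≤ B) : ∫ x, g x * g x ≤ B := by
  let b : ℕ → ContDiffBump (0 : E) := fun n =>
    ⟨1 / (n + 1 : ℝ) / 2, 1 / (n + 1 : ℝ), by positivity, half_lt_self (by positivity)⟩
  let φ : ℕ → E → ℝ := fun n => (b n).normed volume ⋆[ContinuousLinearMap.lsmul ℝ ℝ, volume] g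
  have hlim : ∀ᵐ x, Tendsto (fun n => φ n x) atTop (𝓝 (g x)) := by
    refine ContDiffBump.ae_convolution_tendsto_right_of_locallyIntegrable (K := 2)
      tendsto_one_div_add_atTop_nhds_zero_nat (Eventually.of_forall fun n => ?_)
      hi.locallyIntegrable
    change 1 / (n + 1 : ℝ) ≤ 2 * (1 / (n + 1 : ℝ) / 2)
    linarith
  have hφ1 : ∀ n, ContDiff ℝ 1 (φ n) := fun n =>
    (b n).hasCompactSupport_normed.contDiff_convolution_left (n := 1) _ (b n).contDiff_normed
      hi.locallyIntegrable
  have hφb : ∀ n x, |φ n x| ≤ 1 := by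
    intro n x
    have h1 : ‖φ n x‖ ≤ ∫ t, (b n).normed volume t := by
      refine norm_integral_le_of_norm_le (b n).integrable_normed (Eventually.of_forall fun t => ?_)
      rw [ContinuousLinearMap.lsmul_apply, norm_smul, Real.norm_of_nonneg ((b n).nonneg_normed t)]
      exact mul_le_of_le_one_right ((b n).nonneg_normed t) (hb _)
    rwa [(b n).integral_normed] at h1
  have hT : Tendsto (fun n => ∫ x, g x * φ n x) atTop (𝓝 (∫ x, g x * g x)) := by
    refine tendsto_integral_of_dominated_convergence (fun x => ‖g x‖)
      (fun n => hi.aestronglyMeasurable.mul (hφ1 n).continuous.aestronglyMeasurable) hi.norm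
      (fun n => Eventually.of_forall fun x => ?_) ?_
    · rw [norm_mul]
      exact mul_le_of_le_one_right (norm_nonneg _) (hφb n x)
    · filter_upwards [hlim] with x hx
      exact hx.const_mul _
  exact le_of_tendsto' hT fun n => h _ (hφ1 n)
    ((b n).hasCompactSupport_normed.convolution _ hc) (hφb n)

/-- Translating a set by `v` changes it by at most `‖v‖` times its perimeter. -/
lemma lintegral_enorm_indicator_sub_le {Ω : Set E} (hΩ : IsCompact Ω)
    (hf : variation (Ω.indicator fun _ => (1 : ℝ)) < ∞) (v : E) :
    ∫⁻ x, ‖Ω.indicator (fun _ => (1 : ℝ)) x - Ω.indicator (fun _ => (1 : ℝ)) (x - v)‖ₑ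
      ≤ ‖v‖ₑ * variation (Ω.indicator fun _ => (1 : ℝ)) := by
  set χ : E → ℝ := Ω.indicator fun _ => (1 : ℝ) with hχ
  have hi : Integrable χ := (integrable_indicator_iff hΩ.measurableSet).2
    (integrableOn_const hΩ.measure_lt_top.ne)
  have hi' : Integrable fun x => χ (x - v) := hi.comp_sub_right v
  have hcs : HasCompactSupport χ := HasCompactSupport.intro hΩ fun x hx => by simp [hχ, hx]
  have hcs' : HasCompactSupport fun x => χ (x - v) :=
    hcs.comp_homeomorph (Homeomorph.subRight v)
  have h01 : ∀ x, χ x = 0 ∨ χ x = 1 := fun x => by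
    by_cases hx : x ∈ Ω <;> simp [hχ, hx]
  have hsq : ∀ x, (χ (x - v) - χ x) * (χ (x - v) - χ x) = ‖χ x - χ (x - v)‖ := by
    intro x
    rcases h01 x with h | h <;> rcases h01 (x - v) with h' | h' <;> simp [h, h']
  have key : ∫ x, (χ (x - v) - χ x) * (χ (x - v) - χ x) ≤ ‖v‖ * (variation χ).toReal := by
    refine integral_sq_le_of_forall_integral_mul_le (hi'.sub hi) (fun x => ?_) (hcs'.sub hcs) ?_
    · rcases h01 x with h | h <;> rcases h01 (x - v) with h' | h' <;> simp [h, h']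
    · intro φ hφ hφc hφb
      have h1 := integral_mul_sub_le_variation hi hf hφ hφc hφb v
      refine le_of_eq_of_le ?_ h1
      have hm : ∀ w : E, AEStronglyMeasurable (fun x => φ (x + w)) volume := fun w =>
        (hφ.continuous.comp (continuous_add_const w)).aestronglyMeasurable
      have hb' : ∀ w : E, ∀ᵐ x, ‖φ (x + w)‖ ≤ 1 := fun w =>
        Eventually.of_forall fun x => hφb _
      have i1 : Integrable fun x => χ x * φ (x + v) := hi.mul_bdd (hm v) (hb' v)
      have i2 : Integrable fun x => χ x * φ x := by simpa using hi.mul_bdd (hm 0) (hb' 0)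
      have i3 : Integrable fun x => χ (x - v) * φ x := by simpa using hi'.mul_bdd (hm 0) (hb' 0)
      change ∫ x, (χ (x - v) - χ x) * φ x = _
      simp_rw [sub_mul, mul_sub]
      rw [integral_sub i3 i2, integral_sub i1 i2,
        ← integral_sub_right_eq_self (fun x => χ x * φ (x + v)) v]
      simp
  simp_rw [hsq] at key
  have e1 : ∫⁻ x, ‖χ x - χ (x - v)‖ₑ = ENNReal.ofReal (∫ x, ‖χ x - χ (x - v)‖) :=
    (ofReal_integral_norm_eq_lintegral_enorm (hi.sub hi')).symm
  rw [e1, ← ENNReal.ofReal_toReal hf.ne, ← ofReal_norm, ← ENNReal.ofReal_mul (norm_nonneg v)]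
  exact ENNReal.ofReal_le_ofReal key

end Perimeter

/-! ### Traces and square roots of positive operators -/

section HilbertSpace

variable {H : Type*} [NormedAddCommGroup H] [InnerProductSpace ℂ H]

lemma enorm_inner_symm (x y : H) : ‖⟪x, y⟫_ℂ‖ₑ = ‖⟪y, x⟫_ℂ‖ₑ := by
  rw [← ofReal_norm, norm_inner_symm, ofReal_norm]

lemma enorm_sq_eq_ofReal {F : Type*} [SeminormedAddCommGroup F] (x : F) :
    ‖x‖ₑ ^ 2 = ENNReal.ofReal (‖x‖ ^ 2) := by
  rw [← ofReal_norm, ENNReal.ofReal_pow (norm_nonneg _)]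

/-- Bessel's inequality. -/
lemma Orthonormal.tsum_enorm_inner_sq_le {ι : Type*} {u : ι → H} (hu : Orthonormal ℂ u) (x : H) :
    ∑' i, ‖⟪u i, x⟫_ℂ‖ₑ ^ 2 ≤ ‖x‖ₑ ^ 2 := by
  simp_rw [enorm_sq_eq_ofReal]
  rw [← ENNReal.ofReal_tsum_of_nonneg (fun _ => by positivity) (hu.inner_products_summable x)]
  exact ENNReal.ofReal_le_ofReal (hu.tsum_inner_products_le x)

/-- Parseval's identity. -/
lemma HilbertBasis.tsum_enorm_inner_sq {ι : Type*} (b : HilbertBasis ι ℂ H) (x : H) :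
    ∑' i, ‖⟪b i, x⟫_ℂ‖ₑ ^ 2 = ‖x‖ₑ ^ 2 := by
  simp_rw [enorm_sq_eq_ofReal]
  rw [← ENNReal.ofReal_tsum_of_nonneg (fun _ => by positivity)
    (b.orthonormal.inner_products_summable x)]
  congr 1
  have h := b.tsum_inner_mul_inner x x
  have h2 : ∀ i, ⟪x, b i⟫_ℂ * ⟪b i, x⟫_ℂ = ((‖⟪b i, x⟫_ℂ‖ ^ 2 : ℝ) : ℂ) := by
    intro i
    rw [← inner_conj_symm, mul_comm, Complex.mul_conj, Complex.normSq_eq_norm_sq]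
  simp_rw [h2] at h
  rw [← Complex.ofReal_tsum, inner_self_eq_norm_sq_to_K] at h
  exact Complex.ofReal_injective (h.trans (by simp))

variable [CompleteSpace H]

/-- The positive square root `S^{1/2}` (the junk value `0` if `S` is not positive). -/
def opSqrt (S : H →L[ℂ] H) : H →L[ℂ] H := CFC.sqrt S

lemma inner_opSqrt_left (S : H →L[ℂ] H) (x y : H) :
    ⟪opSqrt S x, y⟫_ℂ = ⟪x, opSqrt S y⟫_ℂ :=
  ((ContinuousLinearMap.nonneg_iff_isPositive _).1 (CFC.sqrt_nonneg S)).isSymmetric x y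

lemma ContinuousLinearMap.IsPositive.opSqrt_comp_opSqrt {S : H →L[ℂ] H} (hS : S.IsPositive) :
    opSqrt S ∘L opSqrt S = S :=
  CFC.sqrt_mul_sqrt_self S ((ContinuousLinearMap.nonneg_iff_isPositive S).2 hS)

lemma ContinuousLinearMap.IsPositive.inner_apply_eq_norm_opSqrt_sq {S : H →L[ℂ] H}
    (hS : S.IsPositive) (x : H) : ⟪x, S x⟫_ℂ = ((‖opSqrt S x‖ ^ 2 : ℝ) : ℂ) := by
  conv_lhs => rw [← hS.opSqrt_comp_opSqrt]
  rw [ContinuousLinearMap.comp_apply, ← inner_opSqrt_left, inner_self_eq_norm_sq_to_K]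
  norm_cast

/-- The vectors `rᵢ = S^{1/2} eᵢ`. They decompose a positive operator as `S = ∑ rᵢ ⊗ rᵢ`. -/
def sqrtVec (S : H →L[ℂ] H) (i : onbIndex H) : H := opSqrt S (onb H i)

lemma tsum_enorm_inner_sqrtVec_sq (S : H →L[ℂ] H) (x : H) :
    ∑' i, ‖⟪sqrtVec S i, x⟫_ℂ‖ₑ ^ 2 = ‖opSqrt S x‖ₑ ^ 2 := by
  simp_rw [sqrtVec, inner_opSqrt_left]
  exact (onb H).tsum_enorm_inner_sq _

lemma summable_norm_sqrtVec_sq {S : H →L[ℂ] H} (hS : S.IsPositive) (h1 : opTrace S = 1) :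
    Summable fun i => ‖sqrtVec S i‖ ^ 2 := by
  have h : opTrace S = ∑' i, ((‖sqrtVec S i‖ ^ 2 : ℝ) : ℂ) :=
    tsum_congr fun i => hS.inner_apply_eq_norm_opSqrt_sq _
  by_contra hc
  rw [h, tsum_eq_zero_of_not_summable (fun hs => hc (Complex.summable_ofReal.1 hs))] at h1
  exact zero_ne_one h1

lemma tsum_enorm_sqrtVec_sq {S : H →L[ℂ] H} (hS : S.IsPositive) (h1 : opTrace S = 1) :
    ∑' i, ‖sqrtVec S i‖ₑ ^ 2 = 1 := by
  have h : opTrace S = ∑' i, ((‖sqrtVec S i‖ ^ 2 : ℝ) : ℂ) :=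
    tsum_congr fun i => hS.inner_apply_eq_norm_opSqrt_sq _
  simp_rw [enorm_sq_eq_ofReal]
  rw [← ENNReal.ofReal_tsum_of_nonneg (fun _ => by positivity) (summable_norm_sqrtVec_sq hS h1)]
  rw [h, ← Complex.ofReal_tsum] at h1
  rw [show ∑' i, ‖sqrtVec S i‖ ^ 2 = 1 by exact_mod_cast h1, ENNReal.ofReal_one]

lemma opTrace_comp_rankOne (A : H →L[ℂ] H) (u : H) :
    opTrace (A ∘L InnerProductSpace.rankOne ℂ u u) = ⟪u, A u⟫_ℂ := by
  rw [← (onb H).tsum_inner_mul_inner u (A u)]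
  refine tsum_congr fun i => ?_
  rw [ContinuousLinearMap.comp_apply, InnerProductSpace.rankOne_apply, map_smul, inner_smul_right]

lemma summable_norm_inner_onb_sq {ι : Type*} {v : ι → H} (hv : Summable fun j => ‖v j‖ ^ 2) :
    Summable fun p : ι × onbIndex H => ‖⟪v p.1, onb H p.2⟫_ℂ‖ ^ 2 := by
  have h : ∑' p : ι × onbIndex H, ENNReal.ofReal (‖⟪v p.1, onb H p.2⟫_ℂ‖ ^ 2) ≠ ∞ := by
    simp_rw [← enorm_sq_eq_ofReal]
    rw [ENNReal.tsum_prod (f := fun a b => ‖⟪v a, onb H b⟫_ℂ‖ₑ ^ 2)]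
    simp_rw [enorm_inner_symm (v _), (onb H).tsum_enorm_inner_sq, enorm_sq_eq_ofReal]
    rw [← ENNReal.ofReal_tsum_of_nonneg (fun _ => by positivity) hv]
    exact ENNReal.ofReal_ne_top
  have h2 := ENNReal.summable_toReal h
  refine h2.congr fun p => ?_
  rw [ENNReal.toReal_ofReal (by positivity)]

/-- Cyclicity of the trace, in the form `tr(R R A) = tr(R A R)` for the Hilbert-Schmidt operator
`R = S^{1/2}`: Parseval's identity turns both sides into the same absolutely summable double
series. -/
lemma opTrace_comp_eq_tsum_sqrtVec {S : H →L[ℂ] H} (hS : S.IsPositive) (h1 : opTrace S = 1)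
    (A : H →L[ℂ] H) :
    opTrace (S ∘L A) = ∑' j, ⟪sqrtVec S j, A (sqrtVec S j)⟫_ℂ := by
  have hr := summable_norm_sqrtVec_sq hS h1
  have hr2 : Summable fun j => ‖ContinuousLinearMap.adjoint A (sqrtVec S j)‖ ^ 2 := by
    refine (hr.mul_left (‖ContinuousLinearMap.adjoint A‖ ^ 2)).of_nonneg_of_le
      (fun _ => by positivity) fun j => ?_
    rw [← mul_pow]
    exact pow_le_pow_left₀ (norm_nonneg _) (ContinuousLinearMap.le_opNorm _ _) 2
  let F : onbIndex H → onbIndex H → ℂ := fun j i =>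
    ⟪ContinuousLinearMap.adjoint A (sqrtVec S j), onb H i⟫_ℂ * ⟪onb H i, sqrtVec S j⟫_ℂ
  have hF : Summable (Function.uncurry F) := by
    refine Summable.of_norm_bounded
      (((summable_norm_inner_onb_sq hr2).add (summable_norm_inner_onb_sq hr)).mul_left (1 / 2))
      fun p => ?_
    rw [Function.uncurry, norm_mul, norm_inner_symm (onb H p.2)]
    nlinarith [sq_nonneg (‖⟪ContinuousLinearMap.adjoint A (sqrtVec S p.1), onb H p.2⟫_ℂ‖
      - ‖⟪sqrtVec S p.1, onb H p.2⟫_ℂ‖)]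
  have hl : ∀ i, ⟪onb H i, (S ∘L A) (onb H i)⟫_ℂ = ∑' j, F j i := by
    intro i
    have e : ⟪onb H i, (S ∘L A) (onb H i)⟫_ℂ
        = ⟪opSqrt S (onb H i), opSqrt S (A (onb H i))⟫_ℂ := by
      conv_lhs => rw [← hS.opSqrt_comp_opSqrt]
      rw [inner_opSqrt_left]
      rfl
    rw [e, ← (onb H).tsum_inner_mul_inner]
    refine tsum_congr fun j => ?_
    simp only [F, sqrtVec]
    rw [inner_opSqrt_left, ContinuousLinearMap.adjoint_inner_left, inner_opSqrt_left, mul_comm]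
  have hrr : ∀ j, ⟪sqrtVec S j, A (sqrtVec S j)⟫_ℂ = ∑' i, F j i := by
    intro j
    rw [(onb H).tsum_inner_mul_inner, ContinuousLinearMap.adjoint_inner_left]
  rw [opTrace]
  simp_rw [hl, hrr]
  exact hF.tsum_comm

instance onbIndex_countable [SecondCountableTopology H] : Countable (onbIndex H) := by
  have h : Orthonormal ℂ (onb H) := (onb H).orthonormal
  have hd : ∀ i j, i ≠ j → 1 ≤ dist (onb H i) (onb H j) := by
    intro i j hij
    have h2 : ‖onb H i - onb H j‖ ^ 2 = 2 := by
      rw [@norm_sub_sq ℂ, h.1, h.1, h.2 hij]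
      norm_num
    rw [dist_eq_norm]
    nlinarith [norm_nonneg (onb H i - onb H j)]
  have hdisj : (Set.univ : Set (onbIndex H)).PairwiseDisjoint
      fun i => Metric.ball (onb H i) (1 / 2) := by
    intro i _ j _ hij
    exact Metric.ball_disjoint_ball (by linarith [hd i j hij])
  have := hdisj.countable_of_isOpen (fun i _ => Metric.isOpen_ball)
    (fun i _ => Metric.nonempty_ball.2 (by norm_num))
  exact Set.countable_univ_iff.1 this

end HilbertSpace

/-! ### Time-frequency shifts and parity -/

section Shifts

variable {d : ℕ}

instance secondCountableTopology_L2Space : SecondCountableTopology (L2Space d) := by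
  have : Fact ((2 : ℝ≥0∞) ≠ ∞) := ⟨ENNReal.ofNat_ne_top⟩
  infer_instance

instance isNegInvariant_phaseSpace : (volume : Measure (PhaseSpace d)).IsNegInvariant :=
  Measure.IsAddHaarMeasure.isNegInvariant_of_regular _

/-- The adjoint `π(z)^*`. -/
abbrev shiftAdjoint (z : PhaseSpace d) : BddOp d :=
  ContinuousLinearMap.adjoint (timeFreqShift z).toContinuousLinearMap

lemma inner_shiftAdjoint_right (z : PhaseSpace d) (f g : L2Space d) :
    ⟪f, shiftAdjoint z g⟫_ℂ = ⟪timeFreqShift z f, g⟫_ℂ :=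
  ContinuousLinearMap.adjoint_inner_right _ _ _

lemma shiftAdjoint_timeFreqShift (z : PhaseSpace d) (f : L2Space d) :
    shiftAdjoint z (timeFreqShift z f) = f := by
  refine ext_inner_left ℂ fun v => ?_
  rw [inner_shiftAdjoint_right]
  exact (timeFreqShift z).inner_map_map v f

lemma norm_shiftAdjoint (z : PhaseSpace d) (f : L2Space d) : ‖shiftAdjoint z f‖ = ‖f‖ := by
  obtain ⟨g, rfl⟩ := timeFreqShift_surjective z f
  rw [shiftAdjoint_timeFreqShift, LinearIsometry.norm_map]

lemma character_add_left (v w t : ConfigSpace d) :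
    character (v + w) t = character v t * character w t := by
  rw [character, character, character, ← Complex.exp_add, inner_add_left]
  push_cast
  ring_nf

lemma character_add_right (w s t : ConfigSpace d) :
    character w (s + t) = character w s * character w t := by
  rw [character, character, character, ← Complex.exp_add, inner_add_right]
  push_cast
  ring_nf

/-- The time-frequency shifts form a projective representation of phase space. -/
lemma timeFreqShift_comp (z u : PhaseSpace d) (f : L2Space d) :
    timeFreqShift z (timeFreqShift u f)
      = character u.snd (-z.fst) • timeFreqShift (z + u) f := by
  refine Lp.ext ?_
  have h2 : ∀ᵐ t, timeFreqShift u f (t - z.fst)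
      = character u.snd (t - z.fst) * f (t - z.fst - u.fst) :=
    (measurePreserving_sub_right volume z.fst).quasiMeasurePreserving.ae
      (coeFn_timeFreqShift u f)
  filter_upwards [coeFn_timeFreqShift z (timeFreqShift u f), coeFn_timeFreqShift (z + u) f, h2,
    Lp.coeFn_smul (character u.snd (-z.fst)) (timeFreqShift (z + u) f)] with t h1 h3 h2 h4
  rw [h1, h4, Pi.smul_apply, h3, h2, smul_eq_mul, WithLp.add_snd, WithLp.add_fst,
    character_add_left, sub_eq_add_neg t, character_add_right,
    show t - (z.fst + u.fst) = t + -z.fst - u.fst by abel]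
  ring

lemma timeFreqShift_zero (f : L2Space d) : timeFreqShift 0 f = f := by
  refine Lp.ext ?_
  filter_upwards [coeFn_timeFreqShift 0 f] with t ht
  rw [ht]
  simp [character]

lemma enorm_inner_timeFreqShift (w z : PhaseSpace d) (f g : L2Space d) :
    ‖⟪timeFreqShift w f, timeFreqShift z g⟫_ℂ‖ₑ = ‖⟪timeFreqShift (w - z) f, g⟫_ℂ‖ₑ := by
  have h := timeFreqShift_comp z (w - z) f
  rw [add_sub_cancel] at h
  rw [← (timeFreqShift z).inner_map_map (timeFreqShift (w - z) f) g, h, inner_smul_left,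
    enorm_mul, RCLike.enorm_conj, ← ofReal_norm (character _ _), norm_character]
  simp

/-- `π(-z)` equals `π(z)^*` up to a phase. -/
lemma timeFreqShift_neg (z : PhaseSpace d) (f : L2Space d) :
    timeFreqShift (-z) f = character (-z.snd) (-z.fst) • shiftAdjoint z f := by
  have h := congrArg (shiftAdjoint z) (timeFreqShift_comp z (-z) f)
  rw [shiftAdjoint_timeFreqShift, add_neg_cancel, timeFreqShift_zero, map_smul] at h
  exact h

lemma coeFn_parity (f : L2Space d) : parity d f =ᵐ[volume] fun t => f (-t) :=
  Lp.coeFn_compMeasurePreserving f (Measure.measurePreserving_neg volume)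

lemma parity_parity (f : L2Space d) : parity d (parity d f) = f := by
  refine Lp.ext ?_
  have h : ∀ᵐ t, parity d f (-t) = f (- -t) :=
    (Measure.measurePreserving_neg volume).quasiMeasurePreserving.ae (coeFn_parity f)
  filter_upwards [coeFn_parity (parity d f), h] with t h1 h2
  rw [h1, h2, neg_neg]

lemma inner_parity_parity (f g : L2Space d) : ⟪parity d f, parity d g⟫_ℂ = ⟪f, g⟫_ℂ :=
  (Lp.compMeasurePreservingₗᵢ ℂ (fun t : ConfigSpace d => -t)
    (Measure.measurePreserving_neg volume)).inner_map_map f g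

lemma inner_parity_left (f g : L2Space d) : ⟪parity d f, g⟫_ℂ = ⟪f, parity d g⟫_ℂ := by
  rw [← inner_parity_parity, parity_parity]

lemma parity_timeFreqShift_parity (z : PhaseSpace d) (f : L2Space d) :
    parity d (timeFreqShift z (parity d f)) = timeFreqShift (-z) f := by
  refine Lp.ext ?_
  have hn := (Measure.measurePreserving_neg (volume : Measure (ConfigSpace d)))
  have h2 := hn.quasiMeasurePreserving.ae (coeFn_timeFreqShift z (parity d f))
  have h3 := hn.quasiMeasurePreserving.ae
    ((measurePreserving_sub_right volume z.fst).quasiMeasurePreserving.ae (coeFn_parity f))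
  filter_upwards [coeFn_parity (timeFreqShift z (parity d f)), h2, h3,
    coeFn_timeFreqShift (-z) f] with t h1 h2 h3 h4
  rw [h1, h2, h3, h4, WithLp.neg_snd, WithLp.neg_fst, character, character, inner_neg_right,
    inner_neg_left, show -(-t - z.fst) = t - -z.fst by abel]

lemma opCheck_opCheck (A : BddOp d) : opCheck (opCheck A) = A := by
  ext1 f
  simp only [opCheck, ContinuousLinearMap.comp_apply, parity_parity]

lemma opCheck_rankOne (h : L2Space d) :
    opCheck (InnerProductSpace.rankOne ℂ h h)
      = InnerProductSpace.rankOne ℂ (parity d h) (parity d h) := by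
  ext1 f
  simp only [opCheck, ContinuousLinearMap.comp_apply, InnerProductSpace.rankOne_apply, map_smul,
    inner_parity_left]

lemma opShift_apply (z : PhaseSpace d) (A : BddOp d) (f : L2Space d) :
    opShift z A f = timeFreqShift z (A (shiftAdjoint z f)) := rfl

lemma opShift_rankOne (z : PhaseSpace d) (h : L2Space d) :
    opShift z (InnerProductSpace.rankOne ℂ h h)
      = InnerProductSpace.rankOne ℂ (timeFreqShift z h) (timeFreqShift z h) := by
  ext1 f
  rw [opShift_apply]
  simp only [InnerProductSpace.rankOne_apply, map_smul, inner_shiftAdjoint_right]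

end Shifts

/-! ### Cohen class distributions of a density operator -/

section Distributions

variable {d : ℕ}

/-- The Cohen class distribution `⟨h, α_z(S) h⟩ = ‖S^{1/2} π(z)^* h‖²` of a positive operator,
with values in `[0, ∞]`. -/
def cohenDensity (S : BddOp d) (h : L2Space d) (z : PhaseSpace d) : ℝ≥0∞ :=
  ‖opSqrt S (shiftAdjoint z h)‖ₑ ^ 2

/-- The function `S̃(z) = tr(S^{1/2} α_z(S) S^{1/2})` of a positive operator, with values in
`[0, ∞]`. -/
def tildeDensity (S : BddOp d) (z : PhaseSpace d) : ℝ≥0∞ :=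
  ∑' j, cohenDensity S (sqrtVec S j) z

lemma measurable_cohenDensity (S : BddOp d) (h : L2Space d) : Measurable (cohenDensity S h) :=
  (continuous_enorm.comp
    ((opSqrt S).continuous.comp (continuous_timeFreqShift_adjoint h))).measurable.pow_const 2

lemma measurable_tildeDensity (S : BddOp d) : Measurable (tildeDensity S) :=
  Measurable.tsum fun _ => measurable_cohenDensity S _

lemma cohenDensity_ne_top (S : BddOp d) (h : L2Space d) (z : PhaseSpace d) :
    cohenDensity S h z ≠ ∞ := by
  unfold cohenDensity; finiteness

lemma toReal_cohenDensity (S : BddOp d) (h : L2Space d) (z : PhaseSpace d) :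
    (cohenDensity S h z).toReal = ‖opSqrt S (shiftAdjoint z h)‖ ^ 2 := by
  rw [cohenDensity, enorm_sq_eq_ofReal, ENNReal.toReal_ofReal (by positivity)]

lemma cohenDensity_eq_tsum (S : BddOp d) (h : L2Space d) (z : PhaseSpace d) :
    cohenDensity S h z = ∑' i, ‖⟪timeFreqShift z (sqrtVec S i), h⟫_ℂ‖ₑ ^ 2 := by
  rw [cohenDensity, ← tsum_enorm_inner_sqrtVec_sq]
  simp_rw [inner_shiftAdjoint_right]

lemma inner_opShift_eq_cohenDensity {S : BddOp d} (hS : S.IsPositive) (h : L2Space d)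
    (z : PhaseSpace d) : ⟪h, opShift z S h⟫_ℂ = ((cohenDensity S h z).toReal : ℂ) := by
  rw [toReal_cohenDensity, ← hS.inner_apply_eq_norm_opSqrt_sq, opShift_apply,
    ← inner_conj_symm, ← inner_shiftAdjoint_right, inner_conj_symm]

lemma cohen_eq_cohenDensity {S : BddOp d} (hS : S.IsPositive) (h : L2Space d)
    (z : PhaseSpace d) : cohen S h z = ((cohenDensity S h z).toReal : ℂ) := by
  rw [cohen, opConv, opCheck_rankOne, opShift_rankOne, opTrace_comp_rankOne, opCheck]
  simp only [ContinuousLinearMap.comp_apply]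
  rw [← inner_parity_left, parity_timeFreqShift_parity, timeFreqShift_neg,
    hS.inner_apply_eq_norm_opSqrt_sq, map_smul, norm_smul, norm_character, one_mul,
    toReal_cohenDensity]

lemma ofReal_tildeFun {S : BddOp d} (hS : IsDensityOperator S) (z : PhaseSpace d) :
    ENNReal.ofReal (tildeFun S z) = tildeDensity S z := by
  have h0 : Summable fun j => ‖opSqrt S (shiftAdjoint z (sqrtVec S j))‖ ^ 2 := by
    refine ((summable_norm_sqrtVec_sq hS.pos hS.trace_eq_one).mul_left
      (‖opSqrt S‖ ^ 2)).of_nonneg_of_le (fun _ => by positivity) fun j => ?_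
    rw [← mul_pow, ← norm_shiftAdjoint z (sqrtVec S j)]
    exact pow_le_pow_left₀ (norm_nonneg _) (ContinuousLinearMap.le_opNorm _ _) 2
  rw [tildeFun, opConv, opCheck_opCheck, opTrace_comp_eq_tsum_sqrtVec hS.pos hS.trace_eq_one]
  simp_rw [inner_opShift_eq_cohenDensity hS.pos, toReal_cohenDensity]
  rw [← Complex.ofReal_tsum, Complex.ofReal_re,
    ENNReal.ofReal_tsum_of_nonneg (fun _ => by positivity) h0]
  exact tsum_congr fun j => (enorm_sq_eq_ofReal _).symm

lemma tildeFun_nonneg {S : BddOp d} (hS : IsDensityOperator S) (z : PhaseSpace d) :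
    0 ≤ tildeFun S z := by
  rw [tildeFun, opConv, opCheck_opCheck, opTrace_comp_eq_tsum_sqrtVec hS.pos hS.trace_eq_one]
  simp_rw [inner_opShift_eq_cohenDensity hS.pos]
  rw [← Complex.ofReal_tsum, Complex.ofReal_re]
  exact tsum_nonneg fun _ => ENNReal.toReal_nonneg

/-- `Q_S(h)` has integral `‖h‖²`, by Moyal's identity. -/
lemma lintegral_cohenDensity {S : BddOp d} (hS : IsDensityOperator S) (h : L2Space d) :
    ∫⁻ z, cohenDensity S h z = ‖h‖ₑ ^ 2 := by
  simp_rw [cohenDensity_eq_tsum]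
  rw [lintegral_tsum fun i => (((continuous_timeFreqShift _).inner
    continuous_const).measurable.enorm.pow_const 2).aemeasurable]
  simp_rw [lintegral_enorm_inner_timeFreqShift_sq]
  rw [ENNReal.tsum_mul_right, tsum_enorm_sqrtVec_sq hS.pos hS.trace_eq_one, one_mul]

lemma lintegral_tildeDensity {S : BddOp d} (hS : IsDensityOperator S) :
    ∫⁻ z, tildeDensity S z = 1 := by
  unfold tildeDensity
  rw [lintegral_tsum fun i => (measurable_cohenDensity S _).aemeasurable]
  simp_rw [lintegral_cohenDensity hS]
  exact tsum_enorm_sqrtVec_sq hS.pos hS.trace_eq_one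

lemma tsum_enorm_inner_timeFreqShift_sqrtVec_comm {ι : Type*} (S : BddOp d) (u : ι → L2Space d)
    (z : PhaseSpace d) : ∑' k, cohenDensity S (u k) z
      = ∑' i, ∑' k, ‖⟪u k, timeFreqShift z (sqrtVec S i)⟫_ℂ‖ₑ ^ 2 := by
  simp_rw [cohenDensity_eq_tsum, enorm_inner_symm _ (timeFreqShift z _)]
  rw [ENNReal.tsum_comm]

lemma enorm_timeFreqShift (z : PhaseSpace d) (f : L2Space d) : ‖timeFreqShift z f‖ₑ = ‖f‖ₑ := by
  rw [← ofReal_norm, LinearIsometry.norm_map, ofReal_norm]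

/-- `tr α_z(S) = 1`. -/
lemma tsum_cohenDensity_onb {S : BddOp d} (hS : IsDensityOperator S) (z : PhaseSpace d) :
    ∑' i, cohenDensity S (onb (L2Space d) i) z = 1 := by
  rw [tsum_enorm_inner_timeFreqShift_sqrtVec_comm]
  simp_rw [(onb (L2Space d)).tsum_enorm_inner_sq, enorm_timeFreqShift]
  exact tsum_enorm_sqrtVec_sq hS.pos hS.trace_eq_one

lemma tsum_cohenDensity_le_one {S : BddOp d} (hS : IsDensityOperator S) {ι : Type*}
    {u : ι → L2Space d} (hu : Orthonormal ℂ u) (z : PhaseSpace d) :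
    ∑' k, cohenDensity S (u k) z ≤ 1 := by
  rw [tsum_enorm_inner_timeFreqShift_sqrtVec_comm,
    ← tsum_enorm_sqrtVec_sq hS.pos hS.trace_eq_one]
  refine ENNReal.tsum_le_tsum fun i => ?_
  rw [← enorm_timeFreqShift z]
  exact hu.tsum_enorm_inner_sq_le _

/-- `tr(α_z(S)^{1/2} α_w(S) α_z(S)^{1/2}) = S̃(w - z)`. -/
lemma tsum_cohenDensity_timeFreqShift_sqrtVec (S : BddOp d) (w z : PhaseSpace d) :
    ∑' j, cohenDensity S (timeFreqShift z (sqrtVec S j)) w = tildeDensity S (w - z) := by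
  simp_rw [tildeDensity, cohenDensity_eq_tsum, enorm_inner_timeFreqShift]

lemma tildeDensity_neg (S : BddOp d) (z : PhaseSpace d) :
    tildeDensity S (-z) = tildeDensity S z := by
  simp_rw [tildeDensity, cohenDensity_eq_tsum]
  rw [ENNReal.tsum_comm]
  refine tsum_congr fun i => tsum_congr fun j => ?_
  have h := enorm_inner_timeFreqShift 0 z (sqrtVec S i) (sqrtVec S j)
  rw [zero_sub, timeFreqShift_zero] at h
  rw [← h, enorm_inner_symm]

lemma tildeDensity_sub_comm (S : BddOp d) (z w : PhaseSpace d) :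
    tildeDensity S (z - w) = tildeDensity S (w - z) := by
  rw [← tildeDensity_neg, neg_sub]

end Distributions

/-! ### Plunge of the eigenvalues -/

section Eigenvalues

/-- The eigenvalues `1 ≥ λ₀ ≥ λ₁ ≥ … ≥ 0` plunge from `1` to `0` near the index `⌈∑ λₖ⌉`: both
the mass of the tail and the defect of the head are controlled by `∑ λₖ - ∑ λₖ²`. -/
lemma sum_one_sub_and_tsum_tail_le {lam : ℕ → ℝ} (ha : Antitone lam) (h0 : ∀ k, 0 ≤ lam k)
    (h1 : ∀ k, lam k ≤ 1) {V Q M : ℝ} (hV : HasSum lam V) (hQ : HasSum (fun k => lam k ^ 2) Q)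
    (hM : V ≤ Q + M) :
    ∑ k ∈ Finset.range ⌈V⌉₊, (1 - lam k) ≤ 1 + M ∧ ∑' k, lam (k + ⌈V⌉₊) ≤ M := by
  set N := ⌈V⌉₊ with hN
  set b := ∑' k, lam (k + N) with hb
  have hs : Summable fun k => lam (k + N) := (summable_nat_add_iff N).2 hV.summable
  have e1 : ∑ k ∈ Finset.range N, lam k + b = V := by
    rw [← hV.tsum_eq]; exact hV.summable.sum_add_tsum_nat_add N
  have hd : HasSum (fun k => lam k * (1 - lam k)) (V - Q) := by
    refine (hV.sub hQ).congr_fun fun k => ?_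
    ring
  have hds : Summable fun k => lam (k + N) * (1 - lam (k + N)) :=
    (summable_nat_add_iff N).2 hd.summable
  have e2 : ∑ k ∈ Finset.range N, lam k * (1 - lam k)
      + ∑' k, lam (k + N) * (1 - lam (k + N)) = V - Q := by
    rw [← hd.tsum_eq]; exact hd.summable.sum_add_tsum_nat_add N
  have h3 : lam N * ∑ k ∈ Finset.range N, (1 - lam k)
      ≤ ∑ k ∈ Finset.range N, lam k * (1 - lam k) := by
    rw [Finset.mul_sum]
    refine Finset.sum_le_sum fun k hk => mul_le_mul_of_nonneg_right (ha ?_) (by linarith [h1 k])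
    exact (Finset.mem_range.1 hk).le
  have h4 : b * (1 - lam N) ≤ ∑' k, lam (k + N) * (1 - lam (k + N)) := by
    rw [hb, ← tsum_mul_right]
    refine (hs.mul_right _).tsum_le_tsum (fun k => ?_) hds
    exact mul_le_mul_of_nonneg_left (by linarith [ha (Nat.le_add_left N k)]) (h0 _)
  have e5 : ∑ k ∈ Finset.range N, (1 - lam k) = N - ∑ k ∈ Finset.range N, lam k := by
    simp [Finset.sum_sub_distrib]
  have hN1 : V ≤ N := Nat.le_ceil V
  have hN2 : (N : ℝ) < V + 1 := Nat.ceil_lt_add_one (hV.nonneg h0)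
  have hbM : b ≤ M := by
    rw [e5, show ∑ k ∈ Finset.range N, lam k = V - b by linarith] at h3
    nlinarith [mul_nonneg (h0 N) (sub_nonneg.2 hN1)]
  exact ⟨by rw [e5]; linarith, hbM⟩

end Eigenvalues

/-! ### Convolution of an indicator with a probability density -/

section Convolution

variable {E : Type*} [NormedAddCommGroup E] [MeasureSpace E]

/-- The function `z ↦ ∫ |χ_Ω(z) - χ_Ω(w)| θ(z - w) dw`, which bounds the distance between `χ_Ω` and
`χ_Ω * θ` when `∫ θ = 1`. -/
def translationOscillation (θ : E → ℝ≥0∞) (Ω : Set E) (z : E) : ℝ≥0∞ :=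
  ∫⁻ w, ‖Ω.indicator (fun _ => (1 : ℝ)) z - Ω.indicator (fun _ => (1 : ℝ)) w‖ₑ * θ (z - w)

variable [BorelSpace E]

lemma measurable_indicator_one {Ω : Set E} (hΩ : IsCompact Ω) :
    Measurable (Ω.indicator fun _ => (1 : ℝ)) :=
  measurable_const.indicator hΩ.measurableSet

lemma setLIntegral_sub_eq_lintegral_mul (θ : E → ℝ≥0∞) {Ω : Set E} (hΩ : IsCompact Ω) (z : E) :
    ∫⁻ w in Ω, θ (z - w) = ∫⁻ w, ‖Ω.indicator (fun _ => (1 : ℝ)) w‖ₑ * θ (z - w) := by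
  rw [← lintegral_indicator hΩ.measurableSet]
  refine lintegral_congr fun w => ?_
  by_cases hw : w ∈ Ω <;> simp [hw]

variable [NormedSpace ℝ E] [FiniteDimensional ℝ E] [(volume : Measure E).IsAddHaarMeasure]

lemma measurable_translationOscillation {θ : E → ℝ≥0∞} (hθ : Measurable θ) {Ω : Set E}
    (hΩ : IsCompact Ω) :
    Measurable (translationOscillation θ Ω) := by
  have h := measurable_indicator_one hΩ
  refine Measurable.lintegral_prod_right' (f := fun p : E × E =>
    ‖Ω.indicator (fun _ => (1 : ℝ)) p.1 - Ω.indicator (fun _ => (1 : ℝ)) p.2‖ₑ * θ (p.1 - p.2)) ?_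
  exact (((h.comp measurable_fst).sub (h.comp measurable_snd)).enorm).mul
    (hθ.comp (measurable_fst.sub measurable_snd))

/-- Upper bound for `χ_Ω * θ` by `χ_Ω`, for a probability density `θ`. -/
lemma setLIntegral_sub_le_enorm_indicator_add {θ : E → ℝ≥0∞} (hθ : Measurable θ)
    (h1 : ∫⁻ u, θ u = 1) {Ω : Set E} (hΩ : IsCompact Ω) (z : E) :
    ∫⁻ w in Ω, θ (z - w) ≤ ‖Ω.indicator (fun _ => (1 : ℝ)) z‖ₑ + translationOscillation θ Ω z := by
  have hm : Measurable fun w => θ (z - w) := hθ.comp (measurable_const.sub measurable_id)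
  rw [setLIntegral_sub_eq_lintegral_mul θ hΩ]
  rw [← mul_one ‖Ω.indicator (fun _ => (1 : ℝ)) z‖ₑ]
  rw [← h1, ← lintegral_sub_left_eq_self θ z, translationOscillation, ← lintegral_const_mul _ hm,
    ← lintegral_add_left (hm.const_mul _)]
  refine lintegral_mono fun w => ?_
  rw [← add_mul]
  refine mul_le_mul_left ?_ _
  rw [← edist_eq_enorm_sub, edist_comm, ← edist_zero_right, ← edist_zero_right, add_comm]
  exact edist_triangle _ _ _

/-- Lower bound for `χ_Ω * θ` by `χ_Ω`, for a probability density `θ`. -/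
lemma enorm_indicator_le_setLIntegral_add {θ : E → ℝ≥0∞} (hθ : Measurable θ)
    (h1 : ∫⁻ u, θ u = 1) {Ω : Set E} (hΩ : IsCompact Ω) (z : E) :
    ‖Ω.indicator (fun _ => (1 : ℝ)) z‖ₑ
      ≤ (∫⁻ w in Ω, θ (z - w)) + translationOscillation θ Ω z := by
  have hm : Measurable fun w => θ (z - w) := hθ.comp (measurable_const.sub measurable_id)
  rw [setLIntegral_sub_eq_lintegral_mul θ hΩ]
  rw [← mul_one ‖Ω.indicator (fun _ => (1 : ℝ)) z‖ₑ]
  rw [← h1, ← lintegral_sub_left_eq_self θ z, translationOscillation, ← lintegral_const_mul _ hm,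
    ← lintegral_add_left (show Measurable fun w => ‖Ω.indicator (fun _ => (1 : ℝ)) w‖ₑ * θ (z - w)
      from (measurable_indicator_one hΩ).enorm.mul hm)]
  refine lintegral_mono fun w => ?_
  rw [← add_mul]
  refine mul_le_mul_left ?_ _
  rw [← edist_eq_enorm_sub, ← edist_zero_right, ← edist_zero_right, add_comm]
  exact edist_triangle _ _ _

/-- Fubini reduces the total oscillation to the translation estimate for sets of finite
perimeter. -/
lemma lintegral_translationOscillation_le {θ : E → ℝ≥0∞} (hθ : Measurable θ) {Ω : Set E}
    (hΩ : IsCompact Ω)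
    (hf : variation (Ω.indicator fun _ => (1 : ℝ)) < ∞) :
    ∫⁻ z, translationOscillation θ Ω z
      ≤ (∫⁻ u, θ u * ‖u‖ₑ) * variation (Ω.indicator fun _ => (1 : ℝ)) := by
  have hχ := measurable_indicator_one hΩ
  have e1 : ∀ z, translationOscillation θ Ω z = ∫⁻ u, ‖Ω.indicator (fun _ => (1 : ℝ)) z
      - Ω.indicator (fun _ => (1 : ℝ)) (z - u)‖ₑ * θ u := by
    intro z
    rw [translationOscillation, ← lintegral_sub_left_eq_self _ z]
    simp
  simp_rw [e1]
  rw [lintegral_lintegral_swap (Measurable.aemeasurable ((((hχ.comp measurable_fst).sub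
    (hχ.comp (measurable_fst.sub measurable_snd))).enorm).mul (hθ.comp measurable_snd))),
    ← lintegral_mul_const _ (show Measurable fun u => θ u * ‖u‖ₑ from hθ.mul measurable_enorm)]
  refine lintegral_mono fun u => ?_
  have hm : Measurable fun z => ‖Ω.indicator (fun _ => (1 : ℝ)) z
      - Ω.indicator (fun _ => (1 : ℝ)) (z - u)‖ₑ :=
    (hχ.sub (hχ.comp (measurable_sub_const u))).enorm
  dsimp only
  rw [lintegral_mul_const _ hm, mul_comm, mul_assoc]
  exact mul_le_mul_right (lintegral_enorm_indicator_sub_le hΩ hf u) _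

end Convolution

/-! ### Spectrum of the mixed-state localization operator -/

section LocalizationOperator

variable {d : ℕ} {S : BddOp d} {Ω : Set (PhaseSpace d)} {hΩ : IsCompact Ω} {lam : ℕ → ℝ}
  {u : ℕ → L2Space d}

lemma inner_mixedLocOp (hS : IsDensityOperator S) (hΩ : IsCompact Ω) (h : L2Space d) :
    ⟪h, mixedLocOp Ω hΩ S h⟫_ℂ = ((∫⁻ z in Ω, cohenDensity S h z).toReal : ℂ) := by
  rw [mixedLocOp, inner_funOpConv]
  simp_rw [inner_opShift_eq_cohenDensity hS.pos]
  rw [← integral_toReal (measurable_cohenDensity S h).aemeasurable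
    (Eventually.of_forall fun z => (cohenDensity_ne_top S h z).lt_top), ← integral_complex_ofReal,
    ← integral_indicator hΩ.measurableSet]
  congr 1 with z
  by_cases hz : z ∈ Ω <;> simp [charFunSet, hz]

lemma setLIntegral_cohenDensity_le (hS : IsDensityOperator S) (Ω : Set (PhaseSpace d))
    (h : L2Space d) : ∫⁻ z in Ω, cohenDensity S h z ≤ ‖h‖ₑ ^ 2 :=
  (setLIntegral_le_lintegral _ _).trans_eq (lintegral_cohenDensity hS h)

lemma hasSum_mul_norm_inner_sq (hS : IsDensityOperator S)
    (hr : IsSpectralRep (mixedLocOp Ω hΩ S) lam u) (h : L2Space d) :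
    HasSum (fun k => lam k * ‖⟪u k, h⟫_ℂ‖ ^ 2) (∫⁻ z in Ω, cohenDensity S h z).toReal := by
  have h1 := ((innerSL ℂ h) ∘L (ContinuousLinearMap.apply ℂ (L2Space d) h)).hasSum hr.hasSum
  rw [← Complex.hasSum_ofReal, ← inner_mixedLocOp hS hΩ]
  refine h1.congr_fun fun k => ?_
  simp only [ContinuousLinearMap.comp_apply, ContinuousLinearMap.apply_apply, innerSL_apply_apply,
    smul_apply, InnerProductSpace.rankOne_apply, inner_smul_right]
  rw [← inner_conj_symm h (u k), Complex.mul_conj, Complex.normSq_eq_norm_sq]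
  push_cast
  ring

lemma eigenvalue_eq (hS : IsDensityOperator S) (hr : IsSpectralRep (mixedLocOp Ω hΩ S) lam u)
    (k : ℕ) : lam k = (∫⁻ z in Ω, cohenDensity S (u k) z).toReal := by
  refine HasSum.unique ?_ (hasSum_mul_norm_inner_sq hS hr (u k))
  have h := hasSum_single (f := fun j => lam j * ‖⟪u j, u k⟫_ℂ‖ ^ 2) k fun j hj => by
    rw [hr.orthonormal.2 hj]; simp
  simpa [inner_self_eq_norm_sq_to_K, hr.orthonormal.1 k] using h

lemma eigenvalue_nonneg (hS : IsDensityOperator S)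
    (hr : IsSpectralRep (mixedLocOp Ω hΩ S) lam u) (k : ℕ) : 0 ≤ lam k := by
  rw [eigenvalue_eq hS hr]; exact ENNReal.toReal_nonneg

lemma ofReal_eigenvalue (hS : IsDensityOperator S)
    (hr : IsSpectralRep (mixedLocOp Ω hΩ S) lam u) (k : ℕ) :
    ENNReal.ofReal (lam k) = ∫⁻ z in Ω, cohenDensity S (u k) z := by
  rw [eigenvalue_eq hS hr, ENNReal.ofReal_toReal]
  exact ne_top_of_le_ne_top (by finiteness) (setLIntegral_cohenDensity_le hS Ω (u k))

lemma eigenvalue_le_one (hS : IsDensityOperator S)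
    (hr : IsSpectralRep (mixedLocOp Ω hΩ S) lam u) (k : ℕ) : lam k ≤ 1 := by
  have h := setLIntegral_cohenDensity_le hS Ω (u k)
  rw [← ofReal_eigenvalue hS hr, enorm_sq_eq_ofReal, hr.orthonormal.1 k] at h
  simpa using h

/-- The quadratic form of `χ_Ω ⋆ S`, computed from its spectral representation. -/
lemma tsum_eigenvalue_mul_enorm_inner_sq (hS : IsDensityOperator S)
    (hr : IsSpectralRep (mixedLocOp Ω hΩ S) lam u) (h : L2Space d) :
    ∑' k, ENNReal.ofReal (lam k) * ‖⟪u k, h⟫_ℂ‖ₑ ^ 2 = ∫⁻ z in Ω, cohenDensity S h z := by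
  have h1 := hasSum_mul_norm_inner_sq hS hr h
  have h0 := eigenvalue_nonneg hS hr
  simp_rw [enorm_sq_eq_ofReal, ← ENNReal.ofReal_mul (h0 _)]
  rw [← ENNReal.ofReal_tsum_of_nonneg (fun k => mul_nonneg (h0 k) (by positivity)) h1.summable,
    h1.tsum_eq, ENNReal.ofReal_toReal]
  exact ne_top_of_le_ne_top (by finiteness) (setLIntegral_cohenDensity_le hS Ω h)

/-- `tr(χ_Ω ⋆ S) = |Ω|`. -/
lemma tsum_eigenvalue (hS : IsDensityOperator S)
    (hr : IsSpectralRep (mixedLocOp Ω hΩ S) lam u) :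
    ∑' k, ENNReal.ofReal (lam k) = volume Ω := by
  have h1 : ∫⁻ z in Ω, ∑' i, cohenDensity S (onb (L2Space d) i) z = volume Ω := by
    simp_rw [tsum_cohenDensity_onb hS]
    simp
  rw [← h1, lintegral_tsum fun i => (measurable_cohenDensity S _).aemeasurable]
  simp_rw [← tsum_eigenvalue_mul_enorm_inner_sq hS hr]
  rw [ENNReal.tsum_comm]
  refine tsum_congr fun k => ?_
  simp_rw [enorm_inner_symm (u k)]
  rw [ENNReal.tsum_mul_left, (onb (L2Space d)).tsum_enorm_inner_sq, enorm_sq_eq_ofReal,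
    hr.orthonormal.1 k]
  simp

/-- `∑ λₖ Q_S(hₖ) = χ_Ω * S̃`. -/
lemma tsum_eigenvalue_mul_cohenDensity (hS : IsDensityOperator S)
    (hr : IsSpectralRep (mixedLocOp Ω hΩ S) lam u) (z : PhaseSpace d) :
    ∑' k, ENNReal.ofReal (lam k) * cohenDensity S (u k) z
      = ∫⁻ w in Ω, tildeDensity S (z - w) := by
  simp_rw [tildeDensity_sub_comm S z, ← tsum_cohenDensity_timeFreqShift_sqrtVec S _ z]
  rw [lintegral_tsum fun i => (measurable_cohenDensity S _).aemeasurable]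
  simp_rw [← tsum_eigenvalue_mul_enorm_inner_sq hS hr, cohenDensity_eq_tsum]
  rw [ENNReal.tsum_comm]
  simp_rw [ENNReal.tsum_mul_left, enorm_inner_symm (u _)]

/-- `tr((χ_Ω ⋆ S)²) = ∫_Ω χ_Ω * S̃`. -/
lemma tsum_eigenvalue_sq (hS : IsDensityOperator S)
    (hr : IsSpectralRep (mixedLocOp Ω hΩ S) lam u) :
    ∑' k, ENNReal.ofReal (lam k) ^ 2 = ∫⁻ z in Ω, ∫⁻ w in Ω, tildeDensity S (z - w) := by
  simp_rw [← tsum_eigenvalue_mul_cohenDensity hS hr]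
  rw [lintegral_tsum fun k => ((measurable_cohenDensity S _).const_mul _).aemeasurable]
  refine tsum_congr fun k => ?_
  rw [lintegral_const_mul _ (measurable_cohenDensity S _), ← ofReal_eigenvalue hS hr, sq]

end LocalizationOperator

/-! ### Distance between the accumulated distribution and the indicator -/

section Accumulation

variable {d : ℕ} {S : BddOp d} {Ω : Set (PhaseSpace d)} {hΩ : IsCompact Ω} {lam : ℕ → ℝ}
  {u : ℕ → L2Space d}

lemma lintegral_tildeDensity_mul_enorm (hS : IsMopStar S) :
    ∫⁻ z, tildeDensity S z * ‖z‖ₑ = ENNReal.ofReal (mopStarNormSq S) := by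
  have h0 : ∀ z, 0 ≤ tildeFun S z := tildeFun_nonneg hS.toIsDensityOperator
  rw [mopStarNormSq, ofReal_integral_eq_lintegral_ofReal hS.integrable
    (Eventually.of_forall fun z => mul_nonneg (h0 z) (norm_nonneg z))]
  refine lintegral_congr fun z => ?_
  rw [ENNReal.ofReal_mul (h0 z), ofReal_tildeFun hS.toIsDensityOperator, ofReal_norm]

lemma lintegral_translationOscillation_tildeDensity_le (hS : IsMopStar S) (hΩ : IsCompact Ω)
    (hP : perimeter Ω < ∞) :
    ∫⁻ z, translationOscillation (tildeDensity S) Ω z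
      ≤ ENNReal.ofReal (mopStarNormSq S * (perimeter Ω).toReal) := by
  refine (lintegral_translationOscillation_le (measurable_tildeDensity S) hΩ hP).trans_eq ?_
  have h0 : 0 ≤ mopStarNormSq S := integral_nonneg fun z =>
    mul_nonneg (tildeFun_nonneg hS.toIsDensityOperator z) (norm_nonneg z)
  rw [lintegral_tildeDensity_mul_enorm hS, ENNReal.ofReal_mul h0, ENNReal.ofReal_toReal hP.ne]
  rfl

/-- The eigenvalues satisfy `tr(T) - tr(T²) ≤ ‖S‖² |∂Ω|` for `T = χ_Ω ⋆ S`, so they plunge from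
`1` to `0` at the index `⌈|Ω|⌉`. -/
lemma eigenvalue_plunge (hS : IsMopStar S) (hP : perimeter Ω < ∞)
    (hr : IsSpectralRep (mixedLocOp Ω hΩ S) lam u) :
    ∑ k ∈ Finset.range ⌈(volume Ω).toReal⌉₊, (1 - lam k)
        ≤ 1 + mopStarNormSq S * (perimeter Ω).toReal
      ∧ Summable lam ∧ ∑' k, lam (k + ⌈(volume Ω).toReal⌉₊)
        ≤ mopStarNormSq S * (perimeter Ω).toReal := by
  have hD := hS.toIsDensityOperator
  have h0 := eigenvalue_nonneg hD hr
  have h1 := eigenvalue_le_one hD hr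
  have hM0 : 0 ≤ mopStarNormSq S * (perimeter Ω).toReal :=
    mul_nonneg (integral_nonneg fun z => mul_nonneg (tildeFun_nonneg hD z) (norm_nonneg z))
      ENNReal.toReal_nonneg
  have hsum : HasSum lam (volume Ω).toReal := by
    have h := ENNReal.hasSum_toReal (f := fun k => ENNReal.ofReal (lam k))
      (by rw [tsum_eigenvalue hD hr]; exact hΩ.measure_lt_top.ne)
    rw [← ENNReal.tsum_toReal_eq fun _ => ENNReal.ofReal_ne_top, tsum_eigenvalue hD hr] at h
    simpa only [ENNReal.toReal_ofReal (h0 _)] using h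
  have hsq : Summable fun k => lam k ^ 2 := by
    refine hsum.summable.of_nonneg_of_le (fun _ => by positivity) fun k => ?_
    nlinarith [h0 k, h1 k]
  have hθ := measurable_tildeDensity S
  -- integrate `χ_Ω ≤ χ_Ω * S̃ + oscillation` over `Ω`
  have hle : volume Ω ≤ ENNReal.ofReal (∑' k, lam k ^ 2)
      + ENNReal.ofReal (mopStarNormSq S * (perimeter Ω).toReal) := by
    rw [ENNReal.ofReal_tsum_of_nonneg (fun _ => by positivity) hsq]
    simp_rw [ENNReal.ofReal_pow (h0 _)]
    rw [tsum_eigenvalue_sq hD hr]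
    refine le_trans ?_
      (add_le_add_right (lintegral_translationOscillation_tildeDensity_le hS hΩ hP) _)
    refine le_trans ?_ (add_le_add_right (setLIntegral_le_lintegral Ω _) _)
    rw [← lintegral_add_right _ (measurable_translationOscillation hθ hΩ)]
    calc volume Ω = ∫⁻ _z in Ω, 1 := by simp
      _ ≤ _ := by
        refine setLIntegral_mono' hΩ.measurableSet fun z hz => ?_
        simpa [hz] using enorm_indicator_le_setLIntegral_add hθ (lintegral_tildeDensity hD) hΩ z
  rw [← ENNReal.ofReal_add (tsum_nonneg fun _ => by positivity) hM0] at hle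
  have key := sum_one_sub_and_tsum_tail_le hr.antitone h0 h1 hsum hsq.hasSum
    (ENNReal.toReal_le_of_le_ofReal (add_nonneg (tsum_nonneg fun _ => by positivity) hM0) hle)
  exact ⟨key.1, hsum.summable, key.2⟩

/-- An integrable majorant `W` of `|ρ - χ_Ω|`. With `σ = χ_Ω * S̃ = ∑ λₖ Q_S(hₖ)`, the head and tail
estimates for the eigenvalues bound `|ρ - σ|`, and the oscillation of `χ_Ω` bounds `|σ - χ_Ω|`. -/
lemma exists_majorant_sum_cohenDensity_sub_indicator (hS : IsMopStar S) (hP : perimeter Ω < ∞)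
    (hM1 : 1 ≤ mopStarNormSq S * (perimeter Ω).toReal)
    (hr : IsSpectralRep (mixedLocOp Ω hΩ S) lam u) :
    ∃ W : PhaseSpace d → ℝ≥0∞, Measurable W ∧
      ∫⁻ z, W z ≤ ENNReal.ofReal (4 * (mopStarNormSq S * (perimeter Ω).toReal)) ∧
      ∀ z, ∑ k ∈ Finset.range ⌈(volume Ω).toReal⌉₊, cohenDensity S (u k) z
            ≤ ‖Ω.indicator (fun _ => (1 : ℝ)) z‖ₑ + W z ∧
          ‖Ω.indicator (fun _ => (1 : ℝ)) z‖ₑ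
            ≤ ∑ k ∈ Finset.range ⌈(volume Ω).toReal⌉₊, cohenDensity S (u k) z + W z := by
  have hD := hS.toIsDensityOperator
  have h0 := eigenvalue_nonneg hD hr
  have h1 := eigenvalue_le_one hD hr
  obtain ⟨ha, hls, hb⟩ := eigenvalue_plunge hS hP hr
  have hosc := lintegral_translationOscillation_tildeDensity_le hS hΩ hP
  set M := mopStarNormSq S * (perimeter Ω).toReal with hM
  set N := ⌈(volume Ω).toReal⌉₊ with hN
  let q : ℕ → PhaseSpace d → ℝ≥0∞ := fun k => cohenDensity S (u k)
  have hqm : ∀ k, Measurable (q k) := fun k => measurable_cohenDensity S (u k)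
  have hq1 : ∀ k, ∫⁻ z, q k z = 1 := fun k => by
    rw [lintegral_cohenDensity hD, enorm_sq_eq_ofReal, hr.orthonormal.1 k]; simp
  let ρ : PhaseSpace d → ℝ≥0∞ := fun z => ∑ k ∈ Finset.range N, q k z
  let χ : PhaseSpace d → ℝ := Ω.indicator fun _ => 1
  let A : PhaseSpace d → ℝ≥0∞ := fun z =>
    ∑ k ∈ Finset.range N, ENNReal.ofReal (1 - lam k) * q k z
  let B : PhaseSpace d → ℝ≥0∞ := fun z => ∑' k, ENNReal.ofReal (lam (k + N)) * q (k + N) z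
  let D : PhaseSpace d → ℝ≥0∞ := translationOscillation (tildeDensity S) Ω
  let σ : PhaseSpace d → ℝ≥0∞ := fun z => ∑' k, ENNReal.ofReal (lam k) * q k z
  have hσ : ∀ z, σ z = ∫⁻ w in Ω, tildeDensity S (z - w) :=
    tsum_eigenvalue_mul_cohenDensity hD hr
  have hsplit : ∀ z, σ z = ∑ k ∈ Finset.range N, ENNReal.ofReal (lam k) * q k z + B z :=
    fun z => (ENNReal.summable.sum_add_tsum_nat_add'
      (f := fun k => ENNReal.ofReal (lam k) * q k z)).symm
  have hq : ∀ k z,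
      q k z = ENNReal.ofReal (lam k) * q k z + ENNReal.ofReal (1 - lam k) * q k z := by
    intro k z
    rw [← add_mul, ← ENNReal.ofReal_add (h0 k) (by linarith [h1 k])]
    simp
  have hρσ : ∀ z, ρ z ≤ σ z + A z := by
    intro z
    have e : ρ z = ∑ k ∈ Finset.range N, ENNReal.ofReal (lam k) * q k z + A z := by
      rw [← Finset.sum_add_distrib]
      exact Finset.sum_congr rfl fun k _ => hq k z
    rw [e, hsplit]
    gcongr
    exact le_self_add
  have hσρ : ∀ z, σ z ≤ ρ z + B z := by
    intro z
    rw [hsplit]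
    refine add_le_add_left (Finset.sum_le_sum fun k _ => ?_) _
    exact le_self_add.trans_eq (hq k z).symm
  have hσχ : ∀ z, σ z ≤ ‖χ z‖ₑ + D z := fun z => by
    rw [hσ]
    exact setLIntegral_sub_le_enorm_indicator_add (measurable_tildeDensity S)
      (lintegral_tildeDensity hD) hΩ z
  have hχσ : ∀ z, ‖χ z‖ₑ ≤ σ z + D z := fun z => by
    rw [hσ]
    exact enorm_indicator_le_setLIntegral_add (measurable_tildeDensity S)
      (lintegral_tildeDensity hD) hΩ z
  have hAm : Measurable A := Finset.measurable_sum _ fun k _ => (hqm k).const_mul _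
  have hBm : Measurable B := Measurable.tsum fun k => (hqm (k + N)).const_mul _
  have hDm : Measurable D := measurable_translationOscillation (measurable_tildeDensity S) hΩ
  have hAi : ∫⁻ z, A z ≤ ENNReal.ofReal (1 + M) := by
    rw [lintegral_finsetSum _ fun k _ => (hqm k).const_mul _]
    simp_rw [lintegral_const_mul _ (hqm _), hq1, mul_one]
    rw [← ENNReal.ofReal_sum_of_nonneg fun k _ => by linarith [h1 k]]
    exact ENNReal.ofReal_le_ofReal ha
  have hBi : ∫⁻ z, B z ≤ ENNReal.ofReal M := by
    rw [lintegral_tsum fun k => ((hqm (k + N)).const_mul _).aemeasurable]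
    simp_rw [lintegral_const_mul _ (hqm _), hq1, mul_one]
    rw [← ENNReal.ofReal_tsum_of_nonneg (fun k => h0 _) ((summable_nat_add_iff N).2 hls)]
    exact ENNReal.ofReal_le_ofReal hb
  refine ⟨fun z => A z + B z + D z, (hAm.add hBm).add hDm, ?_, fun z => ⟨?_, ?_⟩⟩
  · rw [lintegral_add_right _ hDm, lintegral_add_right _ hBm]
    refine (add_le_add (add_le_add hAi hBi) hosc).trans ?_
    rw [← ENNReal.ofReal_add (by linarith) (by linarith),
      ← ENNReal.ofReal_add (by linarith) (by linarith)]
    -- `(1 + M) + M + M ≤ 4 M`, as `1 ≤ M`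
    exact ENNReal.ofReal_le_ofReal (by linarith)
  · calc ρ z ≤ σ z + A z := hρσ z
      _ ≤ ‖χ z‖ₑ + D z + A z := by gcongr; exact hσχ z
      _ ≤ ‖χ z‖ₑ + D z + A z + B z := le_self_add
      _ = ‖χ z‖ₑ + (A z + B z + D z) := by ring
  · calc ‖χ z‖ₑ ≤ σ z + D z := hχσ z
      _ ≤ ρ z + B z + D z := by gcongr; exact hσρ z
      _ ≤ ρ z + B z + D z + A z := le_self_add
      _ = ρ z + (A z + B z + D z) := by ring

end Accumulation

end

theorem mainTheorem2 :
    ∃ C : ℝ, 0 < C ∧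
      ∀ (d : ℕ) (S : BddOp d) (_ : IsMopStar S)
        (Ω : Set (PhaseSpace d)) (hΩ : IsCompact Ω) (_ : perimeter Ω < ∞)
        (_ : 1 ≤ mopStarNormSq S * (perimeter Ω).toReal)
        (lam : ℕ → ℝ) (h : ℕ → L2Space d) (_ : IsSpectralRep (mixedLocOp Ω hΩ S) lam h)
        (δ : ℝ) (_ : 0 < δ),
        volume {z : PhaseSpace d | δ < ‖accCohen S Ω h z - charFunSet Ω z‖}
          ≤ ENNReal.ofReal (C * (1 / δ ^ 2) * mopStarNormSq S * (perimeter Ω).toReal) := by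
  refine ⟨4, by norm_num, ?_⟩
  intro d S hS Ω hΩ hP hM1 lam h hr δ hδ
  have hD := hS.toIsDensityOperator
  obtain ⟨W, hWm, hWi, hW⟩ := exists_majorant_sum_cohenDensity_sub_indicator hS hP hM1 hr
  set M := mopStarNormSq S * (perimeter Ω).toReal with hM
  set N := ⌈(volume Ω).toReal⌉₊ with hN
  let ρ : PhaseSpace d → ℝ≥0∞ := fun z => ∑ k ∈ Finset.range N, cohenDensity S (h k) z
  have hρ1 : ∀ z, ρ z ≤ 1 := fun z =>
    (ENNReal.sum_le_tsum _).trans (tsum_cohenDensity_le_one hD hr.orthonormal z)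
  have hρe : ∀ z, ENNReal.ofReal (ρ z).toReal = ρ z := fun z =>
    ENNReal.ofReal_toReal (ne_top_of_le_ne_top ENNReal.one_ne_top (hρ1 z))
  have hacc : ∀ z, accCohen S Ω h z = ((ρ z).toReal : ℂ) := by
    intro z
    rw [accCohen, ENNReal.toReal_sum fun k _ => cohenDensity_ne_top S (h k) z, Complex.ofReal_sum]
    exact Finset.sum_congr rfl fun k _ => cohen_eq_cohenDensity hD.pos (h k) z
  let χ : PhaseSpace d → ℝ := Ω.indicator fun _ => 1
  have hχ : ∀ z, charFunSet Ω z = (χ z : ℂ) := by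
    intro z
    by_cases hz : z ∈ Ω <;> simp [charFunSet, χ, hz]
  have hχ01 : ∀ z, χ z = 0 ∨ χ z = 1 := by
    intro z
    by_cases hz : z ∈ Ω <;> simp [χ, hz]
  have hset : {z : PhaseSpace d | δ < ‖accCohen S Ω h z - charFunSet Ω z‖}
      = {z | δ < |(ρ z).toReal - χ z|} := by
    ext z
    rw [Set.mem_ofPred_eq, Set.mem_ofPred_eq, hacc, hχ, ← Complex.ofReal_sub, Complex.norm_real,
      Real.norm_eq_abs]
  rw [hset]
  -- Markov's inequality gives the bound `4 M / δ`, which suffices for `δ ≤ 1`; for `δ > 1` the set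
  -- is empty, because `ρ` and `χ_Ω` take values in `[0, 1]`.
  rcases lt_or_ge 1 δ with hδ1 | hδ1
  · have hempty : {z | δ < |(ρ z).toReal - χ z|} = ∅ := by
      ext z
      simp only [Set.mem_ofPred_eq, Set.mem_empty_iff_false, iff_false, not_lt]
      refine le_trans ?_ hδ1.le
      have hr1 : (ρ z).toReal ≤ 1 :=
        ENNReal.toReal_le_of_le_ofReal zero_le_one (by simpa using hρ1 z)
      have hr0 : 0 ≤ (ρ z).toReal := ENNReal.toReal_nonneg
      rw [abs_le]
      rcases hχ01 z with h | h <;> exact ⟨by linarith, by linarith⟩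
    rw [hempty, measure_empty]
    exact zero_le
  · have hsub : {z | δ < |(ρ z).toReal - χ z|} ⊆ {z | ENNReal.ofReal δ ≤ W z} := by
      intro z hz
      have hχ0 : 0 ≤ χ z := by rcases hχ01 z with h | h <;> linarith
      have hχe : ‖χ z‖ₑ = ENNReal.ofReal (χ z) := by
        rw [← ofReal_norm, Real.norm_of_nonneg hχ0]
      rw [Set.mem_ofPred_eq]
      rcases lt_abs.1 (show δ < |(ρ z).toReal - χ z| from hz) with hz | hz
      · refine (ENNReal.ofReal_le_ofReal hz.le).trans ?_
        rw [ENNReal.ofReal_sub _ hχ0, hρe, ← hχe, tsub_le_iff_left]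
        exact (hW z).1
      · rw [neg_sub] at hz
        refine (ENNReal.ofReal_le_ofReal hz.le).trans ?_
        rw [ENNReal.ofReal_sub _ ENNReal.toReal_nonneg, hρe, ← hχe, tsub_le_iff_left]
        exact (hW z).2
    calc volume {z | δ < |(ρ z).toReal - χ z|}
        ≤ volume {z | ENNReal.ofReal δ ≤ W z} := measure_mono hsub
      _ ≤ (∫⁻ z, W z) / ENNReal.ofReal δ :=
        meas_ge_le_lintegral_div hWm.aemeasurable (by simpa using hδ) ENNReal.ofReal_ne_top
      _ ≤ ENNReal.ofReal (4 * M) / ENNReal.ofReal δ := by gcongr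
      _ = ENNReal.ofReal (4 * M / δ) := (ENNReal.ofReal_div_of_pos hδ).symm
      _ ≤ ENNReal.ofReal (4 * (1 / δ ^ 2) * mopStarNormSq S * (perimeter Ω).toReal) := by
        refine ENNReal.ofReal_le_ofReal ?_
        have e : 4 * (1 / δ ^ 2) * mopStarNormSq S * (perimeter Ω).toReal = 4 * M / δ ^ 2 := by
          rw [hM]; ring
        rw [e]
        refine div_le_div_of_nonneg_left (by linarith) (by positivity) ?_
        nlinarith
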